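/- **Conventions.** A generalized quantum circuit is a circuit over the gate set $\{CNOT,H,T\}$ some of whose wires are initialized to $|0\rangle$ and some of whose wires are traced out at the end; its size is the number of gates plus the numbers of input and output qubits (counting the initialized and the traced-out ones). A QPT algorithm is a family $\{A_\lambda\}_{\lambda\in\mathbb N}$ of generalized circuits of size polynomial in $\lambda$; it is uniform if a deterministic polynomial-time Turing machine outputs the description of $A_\lambda$ on input $1^\lambda$; a non-uniform QPT algorithm additionally gets an arbitrary advice state $\rho_\lambda$ as part of its input. A function $\varepsilon$ is negligible if $\lambda^d\varepsilon(\lambda)\to 0$ for every $d\in\mathbb N$. **Strong QPRG.** A strong quantum pseudorandom generator (sQPRG) with output length $\ell$ is a uniform QPT algorithm $G$ which maps a seed $k\in\{0,1\}^\lambda$ to a random string $G_\lambda(k)\in\{0,1\}^{\ell(\lambda)}$ (obtained by measurement), such that: (i) there are $c>0$ and $\mu(\lambda)=O(\lambda^{-c})$ such that for every $\lambda$ there is $\mathcal K_\lambda\subseteq\{0,1\}^\lambda$ with $|\mathcal K_\lambda|/2^\lambda\ge 1-\mu(\lambda)$ and $\max_y\Pr[G_\lambda(k)=y]\ge 1-\mu(\lambda)$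 for all $k\in\mathcal K_\lambda$; (ii) $\ell(\lambda)>\lambda$ for all $\lambda\ge 1$; (iii) for every non-uniform QPT algorithm $A$ with one output bit, $\bigl|\Pr_{k\gets\{0,1\}^\lambda}[A_\lambda(G_\lambda(k))=1]-\Pr_{y\gets\{0,1\}^{\ell(\lambda)}}[A_\lambda(y)=1]\bigr|$ is negligible. **Construction.** Let $G$ be an sQPRG with output length $3\lambda$. *Commit phase:* the receiver sends a uniform $r\in\{0,1\}^{3\lambda}$; to commit to $b\in\{0,1\}$ the committer samples uniform independent $k_1,\dots,k_\lambda\in\{0,1\}^\lambda$ and sends $\mathsf{Com}=G(k_1)\|\cdots\|G(k_\lambda)$ if $b=0$ and $\mathsf{Com}=(G(k_1)\oplus r)\|\cdots\|(G(k_\lambda)\oplus r)$ if $b=1$. *Reveal phase:* the committer sends $(b,k_1,\dots,k_\lambda)$; the receiver writes $\mathsf{Com}=y_1\|\cdots\|y_\lambda$, runs $G$ afresh on every $k_i$, counts the number $N$ of indices $i$ with $y_i=G(k_i)$ (if $b=0$), respectively $y_i=G(k_i)\oplus r$ (if $b=1$), and outputs $b$ if $N\ge 2\lambda/3$ and $\bot$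 otherwise. All messages are classical. **Theorem.** For every sQPRG $G$ with output length $3\lambda$ the following holds. 1. *Efficiency.* The number of elementary steps of the honest committer and receiver is at most polynomial in $\lambda$, where sampling, XORing, comparing or counting $m$ bits costs $m$ steps, running $G_\lambda$ costs as many steps as the size of its circuit, and each loop iteration costs one step. 2. *Correctness.* There is a negligible $\varepsilon$ such that for all $\lambda$ and $b\in\{0,1\}$, the receiver outputs $b$ with probability at least $1-\varepsilon(\lambda)$ when the honest parties carry out both phases on the bit $b$. 3. *Computational hiding.* For every malicious non-uniform QPT receiver $R^*$ (which prepares a state, measures part of it to obtain the message $r$, and ends the commit phase with the state $\sigma_{R^*}$ consisting of $\mathsf{Com}$ and its remaining qubits) and every non-uniform QPT distinguisher $D$, the difference $\bigl|\Pr[D_\lambda(\sigma_{R^*})=1\mid b=0]-\Pr[D_\lambda(\sigma_{R^*})=1\mid b=1]\bigr|$ is negligible. 4. *Statistical binding.* There is a negligible $\varepsilon$ such that for every $\lambda$ and every computationally unbounded malicious committer, which on receiving a uniform $r$ chooses, possibly at random, a commitment $\mathsf{Com}$ and two decommitments, the probability that two independent executions of the receiver's reveal check on $(r,\mathsf{Com})$,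 with the first and the second decommitment respectively, output $0$ and $1$ is at most $\varepsilon(\lambda)$. -/

import Mathlib

noncomputable section

namespace QCommit

open Matrix Filter
open scoped ComplexOrder

/-- Bit strings of length `n`; also the computational basis labels of `n` qubits. -/
abbrev Bits (n : ℕ) : Type := Fin n → Bool

/-- Operators on `n` qubits, written in the computational basis. -/
abbrev Op (n : ℕ) : Type := Matrix (Bits n) (Bits n) ℂ

/-- Density matrices on `n` qubits. -/
def IsDensity {n : ℕ} (ρ : Op n) : Prop := ρ.PosSemidef ∧ ρ.trace = 1

/-- The tensor product `ρ ⊗ σ`; the qubits of `ρ` come first. -/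
def tensor {m n : ℕ} (ρ : Op m) (σ : Op n) : Op (m + n) := Matrix.of fun x y =>
  ρ (fun i => x (Fin.castAdd n i)) (fun i => y (Fin.castAdd n i)) *
    σ (fun j => x (Fin.natAdd m j)) (fun j => y (Fin.natAdd m j))

/-- The classical mixed state `∑ x, μ x • |x⟩⟨x|` of a random bit string with law `μ`. -/
def classicalState {n : ℕ} (μ : PMF (Bits n)) : Op n :=
  Matrix.diagonal fun x => (((μ x).toReal : ℝ) : ℂ)

/-! ### Generalized quantum circuits over the gate set `{CNOT, H, T}` -/

/-- Elementary gates on `w` wires. -/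
inductive Gate (w : ℕ) : Type
  | H (i : Fin w) : Gate w
  | T (i : Fin w) : Gate w
  | CNOT (c t : Fin w) (h : c ≠ t) : Gate w

/-- The unitary matrix of a gate. -/
def Gate.mat {w : ℕ} : Gate w → Op w
  | .H i => Matrix.of fun x y =>
      if ∀ j, j ≠ i → x j = y j then
        (if x i && y i then -1 else 1) * (((Real.sqrt 2)⁻¹ : ℝ) : ℂ)
      else 0
  | .T i => Matrix.diagonal fun x =>
      if x i then Complex.exp ((Real.pi / 4 : ℝ) * Complex.I) else 1
  | .CNOT c t _ => Matrix.of fun x y =>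
      if x = Function.update y t (xor (y t) (y c)) then 1 else 0

/-- A generalized quantum circuit with `m` input and `n` output qubits. The wires outside the range
of `inp` start in the state `|0⟩`; the wires outside the range of `out` are traced out. -/
structure Circuit (m n : ℕ) : Type where
  wires : ℕ
  inp : Fin m ↪ Fin wires
  out : Fin n ↪ Fin wires
  gates : List (Gate wires)

namespace Circuit

variable {m n : ℕ}

/-- The number of gates plus the numbers of input and of output qubits, where the qubits that are
initialized to zero and those that are traced out are counted. -/
def size (C : Circuit m n) : ℕ := C.gates.length + C.wires + C.wires

/-- The unitary part; the head of the list of gates acts first. -/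
def unitary (C : Circuit m n) : Op C.wires := C.gates.foldl (fun U g => g.mat * U) 1

/-- The isometry `|u⟩ ↦ |u⟩ ⊗ |0⋯0⟩` that adds the qubits initialized to zero. -/
def initIso (C : Circuit m n) : Matrix (Bits C.wires) (Bits m) ℂ := Matrix.of fun x u =>
  if x = Function.extend C.inp u (fun _ => false) then 1 else 0

/-- The partial trace over the wires that are not output wires. -/
def traceOut (C : Circuit m n) (σ : Op C.wires) : Op n := Matrix.of fun u v =>
  ∑ x : Bits C.wires, ∑ y : Bits C.wires,
    if (∀ i, x (C.out i) = u i) ∧ (∀ i, y (C.out i) = v i) ∧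
        (∀ j, j ∉ Set.range C.out → x j = y j) then σ x y else 0

/-- The quantum channel of a generalized circuit. -/
def run (C : Circuit m n) (ρ : Op m) : Op n :=
  C.traceOut ((C.unitary * C.initIso) * ρ * (C.unitary * C.initIso)ᴴ)

end Circuit

theorem Gate.mat_unitary {w : ℕ} (g : Gate w) : g.matᴴ * g.mat = 1 := by
  cases g with
  | H i =>
    ext x y
    have hs : (((Real.sqrt 2)⁻¹ : ℝ) : ℂ) * (((Real.sqrt 2)⁻¹ : ℝ) : ℂ) = 1 / 2 := by
      rw [← Complex.ofReal_mul, ← mul_inv, Real.mul_self_sqrt (by norm_num)]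
      push_cast
      norm_num
    have hne : Function.update x i false ≠ Function.update x i true := fun h => by
      simpa using congrFun h i
    rw [Matrix.mul_apply, ← Finset.sum_subset
      (Finset.subset_univ {Function.update x i false, Function.update x i true}),
      Finset.sum_pair hne]
    · have key : ∀ b : Bool, (∀ j, j ≠ i → Function.update x i b j = x j) := fun b j hj => by
        simp [hj]
      have key2 : ∀ b : Bool, (∀ j, j ≠ i → Function.update x i b j = y j) ↔
          (∀ j, j ≠ i → x j = y j) := fun b =>
        forall_congr' fun j => forall_congr' fun hj => by simp [hj]
      simp only [Gate.mat, Matrix.conjTranspose_apply, Matrix.of_apply, key2, Function.update_self]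
      simp only [if_pos (key _)]
      by_cases hxy : ∀ j, j ≠ i → x j = y j
      · have hiff : x = y ↔ x i = y i := by
          refine ⟨fun h => h ▸ rfl, fun h => funext fun j => ?_⟩
          by_cases hj : j = i
          · rw [hj, h]
          · exact hxy j hj
        rw [Matrix.one_apply]
        simp only [hiff, if_pos hxy]
        have hc : (starRingEnd ℂ) (((Real.sqrt 2)⁻¹ : ℝ) : ℂ) = (((Real.sqrt 2)⁻¹ : ℝ) : ℂ) :=
          Complex.conj_ofReal _
        generalize (((Real.sqrt 2)⁻¹ : ℝ) : ℂ) = a at hs hc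
        cases x i <;> cases y i <;> simp [hc] <;> linear_combination 2 * hs
      · have hne' : x ≠ y := fun h => hxy fun j _ => by rw [h]
        simp [hxy, hne']
    · intro z _ hz
      have hzx : ¬ ∀ j, j ≠ i → z j = x j := by
        intro h
        apply hz
        have : z = Function.update x i (z i) := by
          funext j
          by_cases hj : j = i
          · subst hj
            simp
          · simp [hj, h j hj]
        rw [this]
        cases z i <;> simp
      simp only [Gate.mat, Matrix.conjTranspose_apply, Matrix.of_apply, if_neg hzx, star_zero,
        zero_mul]
  | T i =>
    simp only [Gate.mat, Matrix.diagonal_conjTranspose, Matrix.diagonal_mul_diagonal]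
    rw [← Matrix.diagonal_one]
    congr 1
    funext x
    by_cases hx : x i
    · simp only [Pi.star_apply, hx, if_true]
      rw [Complex.star_def, ← Complex.normSq_eq_conj_mul_self, Complex.normSq_eq_norm_sq,
        Complex.norm_exp_ofReal_mul_I]
      simp
    · simp [hx]
  | CNOT c t h =>
    have hinv : Function.Injective fun y : Bits w => Function.update y t (xor (y t) (y c)) := by
      intro x y hxy
      have hj : ∀ j, j ≠ t → x j = y j := fun j hj => by
        simpa [hj] using congrFun hxy j
      funext j
      by_cases hjt : j = t
      · have h1 := congrFun hxy t
        simp only [Function.update_self, hj c h] at h1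
        rw [hjt]
        exact Bool.xor_left_inj.mp h1
      · exact hj j hjt
    ext x y
    rw [Matrix.mul_apply]
    simp only [Gate.mat, Matrix.conjTranspose_apply, Matrix.of_apply, apply_ite star, star_one, star_zero,
      mul_ite, mul_one, mul_zero]
    rw [Finset.sum_ite_eq' Finset.univ (Function.update y t (xor (y t) (y c)))]
    simp only [Finset.mem_univ, if_true, Matrix.one_apply]
    by_cases hxy : x = y
    · simp [hxy]
    · rw [if_neg hxy, if_neg]
      exact fun h' => hxy (hinv h').symm

namespace Circuit

variable {m n : ℕ}

theorem isometry (C : Circuit m n) :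
    (C.unitary * C.initIso)ᴴ * (C.unitary * C.initIso) = 1 := by
  have hU : ∀ (l : List (Gate C.wires)) (U : Op C.wires), Uᴴ * U = 1 →
      (l.foldl (fun U g => g.mat * U) U)ᴴ * l.foldl (fun U g => g.mat * U) U = 1 := by
    intro l
    induction l with
    | nil => exact fun U h => h
    | cons g l ih =>
      intro U h
      apply ih
      rw [Matrix.conjTranspose_mul, Matrix.mul_assoc, ← Matrix.mul_assoc g.matᴴ, g.mat_unitary,
        Matrix.one_mul, h]
  have hE : C.initIsoᴴ * C.initIso = 1 := by
    ext u v
    rw [Matrix.mul_apply]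
    simp only [initIso, Matrix.conjTranspose_apply, Matrix.of_apply, apply_ite star, star_one, star_zero,
      mul_ite, mul_one, mul_zero]
    rw [Finset.sum_ite_eq' Finset.univ (Function.extend C.inp v fun _ => false)]
    simp only [Finset.mem_univ, if_true, Matrix.one_apply]
    by_cases huv : u = v
    · simp [huv]
    · rw [if_neg huv, if_neg]
      intro h
      apply huv
      funext i
      simpa [C.inp.injective.extend_apply] using (congrFun h (C.inp i)).symm
  have h1 : C.unitaryᴴ * C.unitary = 1 := hU C.gates 1 (by simp)
  rw [Matrix.conjTranspose_mul, Matrix.mul_assoc, ← Matrix.mul_assoc C.unitaryᴴ, h1,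
    Matrix.one_mul, hE]

theorem traceOut_diag (C : Circuit m n) (σ : Op C.wires) (u : Bits n) :
    C.traceOut σ u u = ∑ x : Bits C.wires, if (fun i => x (C.out i)) = u then σ x x else 0 := by
  refine Finset.sum_congr rfl fun x _ => ?_
  rw [Finset.sum_eq_single x]
  · simp [funext_iff]
  · intro y _ hy
    rw [if_neg]
    rintro ⟨h1, h2, h3⟩
    apply hy
    funext j
    by_cases hj : j ∈ Set.range C.out
    · obtain ⟨i, rfl⟩ := hj
      rw [h1, h2]
    · exact (h3 j hj).symm
  · simp

theorem run_diag_sum (C : Circuit m n) (ρ : Op m) : ∑ u, C.run ρ u u = ρ.trace := by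
  simp only [run, traceOut_diag]
  rw [Finset.sum_comm]
  simp only [Finset.sum_ite_eq, Finset.mem_univ, if_true]
  change Matrix.trace _ = _
  rw [Matrix.trace_mul_comm, ← Matrix.mul_assoc, C.isometry, Matrix.one_mul]

theorem run_diag_nonneg (C : Circuit m n) {ρ : Op m} (hρ : ρ.PosSemidef) (u : Bits n) :
    0 ≤ C.run ρ u u := by
  rw [run, traceOut_diag]
  refine Finset.sum_nonneg fun x _ => ?_
  split_ifs
  · exact (hρ.mul_mul_conjTranspose_same _).diag_nonneg
  · exact le_rfl

theorem outDist_aux (C : Circuit m n) (x : Bits m) :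
    ∑ u, ENNReal.ofReal (C.run (classicalState (PMF.pure x)) u u).re = 1 := by
  have hpos : (classicalState (PMF.pure x)).PosSemidef :=
    Matrix.PosSemidef.diagonal fun y => by
      simp only [Pi.zero_apply]
      exact_mod_cast ENNReal.toReal_nonneg
  have htr : (classicalState (PMF.pure x)).trace = 1 := by
    simp [classicalState, Matrix.trace_diagonal, PMF.pure_apply, apply_ite ENNReal.toReal,
      apply_ite Complex.ofReal]
  rw [← ENNReal.ofReal_sum_of_nonneg fun u _ => (Complex.le_def.mp (C.run_diag_nonneg hpos u)).1,
    ← Complex.re_sum, C.run_diag_sum, htr]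
  simp

/-- The law of the bit string obtained by running the circuit on the basis state `|x⟩⟨x|` and
measuring all output qubits in the computational basis. -/
def outDist (C : Circuit m n) (x : Bits m) : PMF (Bits n) :=
  PMF.ofFintype (fun u => ENNReal.ofReal (C.run (classicalState (PMF.pure x)) u u).re)
    (C.outDist_aux x)

/-- Self-delimiting unary code of a number. -/
def encodeNat (k : ℕ) : List Bool := List.replicate k true ++ [false]

/-- Code of a gate: its kind and the wires on which it acts. -/
def encodeGate {w : ℕ} : Gate w → List Bool
  | .H i => encodeNat 1 ++ encodeNat i
  | .T i => encodeNat 2 ++ encodeNat i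
  | .CNOT c t _ => encodeNat 3 ++ encodeNat c ++ encodeNat t

/-- The description of a circuit as a bit string (its length is polynomial in the size). -/
def encode (C : Circuit m n) : List Bool :=
  encodeNat C.wires ++ encodeNat m ++ (List.ofFn fun i => encodeNat (C.inp i)).flatten ++
    encodeNat n ++ (List.ofFn fun i => encodeNat (C.out i)).flatten ++
    (C.gates.map encodeGate).flatten

end Circuit

/-! ### Polynomial-time quantum algorithms -/

/-- `A = {A_n}` is a QPT algorithm: the size of `A_n` is at most polynomial in `n`. -/
def IsQPT {m k : ℕ → ℕ} (A : ∀ n, Circuit (m n) (k n)) : Prop :=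
  ∃ p : Polynomial ℕ, ∀ n, (A n).size ≤ p.eval n

/-- A deterministic polynomial-time Turing machine maps `1ⁿ` to the description of `A_n`. -/
def IsUniform {m k : ℕ → ℕ} (A : ∀ n, Circuit (m n) (k n)) : Prop :=
  Nonempty (Turing.TM2ComputableInPolyTime (fun n : ℕ => List.replicate n true)
    (fun l : List Bool => l) (fun n => (A n).encode))

/-- A non-uniform QPT algorithm with `m n` input and `k n` output qubits: polynomial-size circuits
together with arbitrary quantum advice states. Ordinary QPT algorithms are those with
`adviceLen = 0`. -/
structure NonuniformQPT (m k : ℕ → ℕ) : Type where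
  adviceLen : ℕ → ℕ
  circuit : ∀ n, Circuit (m n + adviceLen n) (k n)
  advice : ∀ n, Op (adviceLen n)
  advice_density : ∀ n, IsDensity (advice n)
  poly : IsQPT circuit

/-- The output state of the algorithm on the input state `ρ`. -/
def NonuniformQPT.run {m k : ℕ → ℕ} (A : NonuniformQPT m k) (n : ℕ) (ρ : Op (m n)) : Op (k n) :=
  (A.circuit n).run (tensor ρ (A.advice n))

/-- The probability that an algorithm with one output qubit outputs `1` on the input state `ρ`. -/
def NonuniformQPT.accept {m : ℕ → ℕ} (A : NonuniformQPT m fun _ => 1) (n : ℕ) (ρ : Op (m n)) : ℝ :=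
  (A.run n ρ (fun _ => true) (fun _ => true)).re

/-- Negligible functions of the security parameter. -/
def Negligible (ε : ℕ → ℝ) : Prop :=
  Asymptotics.SuperpolynomialDecay atTop (fun n : ℕ => (n : ℝ)) ε

/-! ### Strong quantum pseudorandom generators -/

/-- `G` has pseudodeterminism `1 - μ`. -/
def Pseudodeterministic {ℓ : ℕ → ℕ} (G : ∀ n, Circuit n (ℓ n)) (μ : ℕ → ℝ) : Prop :=
  ∀ n, ∃ K : Finset (Bits n),
    1 - μ n ≤ (K.card : ℝ) / 2 ^ n ∧
    ∀ k ∈ K, ∃ y : Bits (ℓ n), 1 - μ n ≤ ((G n).outDist k y).toReal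

/-- Strong pseudodeterministic quantum pseudorandom generators with output length `ℓ`. The weak
security property is implied by the strong one. -/
structure IsStrongQPRG (ℓ : ℕ → ℕ) (G : ∀ n, Circuit n (ℓ n)) : Prop where
  qpt : IsQPT G
  uniform : IsUniform G
  pseudodeterminism : ∃ c : ℝ, 0 < c ∧ ∃ μ : ℕ → ℝ,
    (μ =O[atTop] fun n : ℕ => (n : ℝ) ^ (-c)) ∧ Pseudodeterministic G μ
  stretch : ∀ n, 0 < n → n < ℓ n
  strong_security : ∀ A : NonuniformQPT ℓ fun _ => 1,
    Negligible fun n =>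
      |A.accept n (classicalState ((PMF.uniformOfFintype (Bits n)).bind (G n).outDist)) -
        A.accept n (classicalState (PMF.uniformOfFintype (Bits (ℓ n))))|

/-! ### Randomized procedures with a step count

The honest parties are written in this monad, whose state counts elementary steps. -/

/-- Randomized procedures with result in `α` and a running step count. -/
abbrev Timed (α : Type) : Type := StateT ℕ PMF α

namespace Timed

/-- Spend `c` steps. -/
def tick (c : ℕ) : Timed Unit := fun t => PMF.pure ((), t + c)

/-- Sample from a distribution (at no cost; only used below together with `tick`). -/
def draw {α : Type} (μ : PMF α) : Timed α := fun t => μ.map fun a => (a, t)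

/-- The law of the result. -/
def dist {α : Type} (x : Timed α) : PMF α := (x.run 0).map Prod.fst

/-- Every execution takes at most `T` steps. -/
def TimeLE {α : Type} (x : Timed α) (T : ℕ) : Prop := ∀ a ∈ (x.run 0).support, a.2 ≤ T

/-- Sampling a uniform string of `m` bits: `m` steps. -/
def sampleBits (m : ℕ) : Timed (Bits m) := do
  tick m
  draw (PMF.uniformOfFintype (Bits m))

/-- Running a quantum circuit on a classical input and measuring its output: as many steps as the
size of the circuit. -/
def eval {m n : ℕ} (C : Circuit m n) (x : Bits m) : Timed (Bits n) := do
  tick C.size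
  draw (C.outDist x)

/-- The bitwise exclusive or: `m` steps. -/
def xorBits {m : ℕ} (x y : Bits m) : Timed (Bits m) := do
  tick m
  pure fun j => xor (x j) (y j)

/-- The test whether two strings of `m` bits are equal: `m` steps. -/
def eqBits {m : ℕ} (x y : Bits m) : Timed Bool := do
  tick m
  pure (decide (x = y))

/-- The number of ones among `m` bits: `m` steps. -/
def count {m : ℕ} (e : Bits m) : Timed ℕ := do
  tick m
  pure (Finset.univ.filter fun i => e i = true).card

/-- The loop `for i = 1, …, m`, collecting the results; one additional step per iteration. -/
def forFin {α : Type} : (m : ℕ) → (Fin m → Timed α) → Timed (Fin m → α)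
  | 0, _ => pure Fin.elim0
  | m + 1, f => do
    tick 1
    let a ← f 0
    let v ← forFin m fun i => f i.succ
    pure (Fin.cons a v)

end Timed

/-! ### Bit commitments with classical communication -/

/-- Bit commitment schemes in which all messages are classical, the commit phase consists of a
message of the receiver followed by one of the committer, and the reveal phase of one message of
the committer (which the committer keeps from the commit phase on) and a check by the receiver. -/
structure CommitmentScheme : Type 1 where
  /-- length of the receiver's message -/
  qLen : ℕ → ℕ
  /-- length of the committer's message in the commit phase -/
  cLen : ℕ → ℕ
  /-- decommitment messages -/
  Opening : ℕ → Type
  /-- the receiver produces its message -/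
  challenge : ∀ n, Timed (Bits (qLen n))
  /-- on a bit and the receiver's message, the committer produces its message and the decommitment -/
  commit : ∀ n, Bool → Bits (qLen n) → Timed (Bits (cLen n) × Opening n)
  /-- the receiver's check in the reveal phase; `none` is the rejection `⊥` -/
  verify : ∀ n, Bits (qLen n) → Bits (cLen n) → Opening n → Timed (Option Bool)

namespace CommitmentScheme

variable (S : CommitmentScheme)

/-- The honest committer and the honest receiver run in polynomial time. -/
def Efficient : Prop :=
  ∃ p : Polynomial ℕ, ∀ n,
    (S.challenge n).TimeLE (p.eval n) ∧
    (∀ b r, (S.commit n b r).TimeLE (p.eval n)) ∧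
    (∀ r c d, (S.verify n r c d).TimeLE (p.eval n))

/-- The receiver's output in an execution of both phases by the honest parties. -/
def honestExp (n : ℕ) (b : Bool) : PMF (Option Bool) := do
  let r ← (S.challenge n).dist
  let cd ← (S.commit n b r).dist
  (S.verify n r cd.1 cd.2).dist

def Correct : Prop :=
  ∃ ε : ℕ → ℝ, Negligible ε ∧ ∀ n b, 1 - ε n ≤ (S.honestExp n b (some b)).toReal

/-- The part of a state of `q + s` qubits that belongs to the outcome `r` of a measurement of the
first `q` qubits: the post-measurement state of the other qubits times the probability of `r`. -/
def outcomePart {q s : ℕ} (σ : Op (q + s)) (r : Bits q) : Op s := Matrix.of fun u v =>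
  σ (Fin.append r u) (Fin.append r v)

/-- The state of a malicious receiver after the commit phase with the honest committer on the bit
`b`. The receiver prepares `qLen n + s n` qubits, its message `r` is the result of measuring the
first `qLen n` of them, and in the end it holds the committer's message and its other qubits. -/
def receiverState {s : ℕ → ℕ} (R : NonuniformQPT (fun _ => 0) fun n => S.qLen n + s n)
    (n : ℕ) (b : Bool) : Op (S.cLen n + s n) :=
  ∑ r : Bits (S.qLen n),
    tensor (classicalState ((S.commit n b r).dist.map Prod.fst)) (outcomePart (R.run n 1) r)

/-- No QPT distinguisher can tell from the state of a malicious QPT receiver after the commit phase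
which bit was committed. Later computations of the receiver are part of the distinguisher. -/
def ComputationallyHiding : Prop :=
  ∀ (s : ℕ → ℕ) (R : NonuniformQPT (fun _ => 0) fun n => S.qLen n + s n)
    (D : NonuniformQPT (fun n => S.cLen n + s n) fun _ => 1),
    Negligible fun n =>
      |D.accept n (S.receiverState R n false) - D.accept n (S.receiverState R n true)|

/-- A malicious committer answers the receiver's message with a message and decommitments for two
reveal phases, which the receiver carries out independently; `true` means that their outputs are
`0` and `1`. As all messages are classical, a computationally unbounded (quantum) committer is just
an arbitrary conditional distribution of these messages given the receiver's. -/
def bindingExp (n : ℕ)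
    (C : Bits (S.qLen n) → PMF (Bits (S.cLen n) × S.Opening n × S.Opening n)) : PMF Bool := do
  let r ← (S.challenge n).dist
  let m ← C r
  let v₀ ← (S.verify n r m.1 m.2.1).dist
  let v₁ ← (S.verify n r m.1 m.2.2).dist
  pure (decide (v₀ = some false) && decide (v₁ = some true))

def StatisticallyBinding : Prop :=
  ∃ ε : ℕ → ℝ, Negligible ε ∧
    ∀ n (C : Bits (S.qLen n) → PMF (Bits (S.cLen n) × S.Opening n × S.Opening n)),
      (S.bindingExp n C true).toReal ≤ ε n

end CommitmentScheme

/-! ### The construction -/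

/-- The concatenation `y₁ || ⋯ || yₙ`. -/
def concat {n m : ℕ} (y : Fin n → Bits m) : Bits (n * m) := fun j =>
  y (finProdFinEquiv.symm j).1 (finProdFinEquiv.symm j).2

/-- The `i`-th block of a concatenation. -/
def block {n m : ℕ} (c : Bits (n * m)) (i : Fin n) : Bits m := fun j => c (finProdFinEquiv (i, j))

/-- The Naor-style commitment scheme built from `G`. -/
def naorCommitment (G : ∀ n, Circuit n (3 * n)) : CommitmentScheme where
  qLen n := 3 * n
  cLen n := n * (3 * n)
  Opening n := Bool × (Fin n → Bits n)
  challenge n := Timed.sampleBits (3 * n)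
  commit n b r := do
    let k ← Timed.forFin n fun _ => Timed.sampleBits n
    let y ← Timed.forFin n fun i => do
      let g ← Timed.eval (G n) (k i)
      if b then Timed.xorBits g r else pure g
    pure (concat y, (b, k))
  verify n r c d := do
    let e ← Timed.forFin n fun i => do
      let g ← Timed.eval (G n) (d.2 i)
      let z ← if d.1 then Timed.xorBits g r else pure g
      Timed.eqBits (block c i) z
    let N ← Timed.count e
    pure (if 2 * n ≤ 3 * N then some d.1 else none)

end QCommit

end

/-! The scheme is Naor's commitment repeated in `n` blocks. Repetition absorbs both the merely
inverse-polynomial determinism of `G` and the seeds on which `G` is genuinely random.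

Correctness and binding rest on the same exponential Markov inequality (`one_le_prod_weight`). Give
each block the weight 64 if some event happens there and 1 otherwise. If the event happens in at
least `n / 3` blocks, the product of the weights is at least `64 ^ (n / 3) = 4 ^ n`. If the blocks
are independent and each expected weight is at most 2, this has probability at most `2 ^ n / 4 ^ n =
2 ^ (-n)`. For correctness the event is a mismatch of two runs on the same random seed
(`mismatchWeight_le`); rejection requires more than `n / 3` mismatches. For binding the event is
that both openings match the block; two sets of at least `2n / 3` blocks share at least `n / 3` of
them (`two_verify_le`).

The expected weight in the binding argument is controlled by `r` alone. Call a seed and an output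
heavy if the output has probability above `1 / 64` on that seed; a seed has fewer than 64 heavy
outputs. If both openings match a block with joint probability above `1 / 64`, then `r` is the
exclusive or of two heavy outputs. There are at most `(64 * 2 ^ n) ^ 2` such strings among the `2 ^
(3 * n)` messages, so a uniform `r` avoids them except with probability `4096 * 2 ^ (-n)`.

Hiding is a hybrid argument (`hybrid_le`). Conditioned on `r`, the receiver's leftover state does
not depend on the bit, and the commitment consists of `n` independent masked outputs of `G`.
Replacing them one at a time by uniform strings reaches the same distribution for both bits, since
masking preserves uniformity. For each `n` the best `r`, block position and remaining blocks are
fixed and given, with the leftover state, as quantum advice to one adversary. It only has to add its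
challenge to one block, which CNOT gates in front of the distinguisher do (`Circuit.run_xorInput`).
The distinguishing advantage is thus at most `2 * n` times that adversary's. -/

noncomputable section

namespace QCommit

open Matrix Filter
open scoped ComplexOrder ENNReal

/-! ### Expectations of discrete random variables -/

/-- The expectation of `f` under `μ`. -/
def Ex {α : Type*} (μ : PMF α) (f : α → ℝ≥0∞) : ℝ≥0∞ := ∑' a, μ a * f a

theorem Ex_pure {α : Type*} (a : α) (f : α → ℝ≥0∞) : Ex (PMF.pure a) f = f a := by
  rw [Ex, tsum_eq_single a]
  · simp
  · intro b hb
    simp [PMF.pure_apply, hb]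

theorem Ex_bind {α β : Type*} (μ : PMF α) (κ : α → PMF β) (f : β → ℝ≥0∞) :
    Ex (μ.bind κ) f = Ex μ fun a => Ex (κ a) f := by
  simp only [Ex, PMF.bind_apply, ← ENNReal.tsum_mul_right, ← ENNReal.tsum_mul_left]
  rw [ENNReal.tsum_comm]
  simp only [mul_assoc]

theorem Ex_map {α β : Type*} (μ : PMF α) (g : α → β) (f : β → ℝ≥0∞) :
    Ex (μ.map g) f = Ex μ fun a => f (g a) := by
  simp only [PMF.map, Ex_bind, Function.comp, Ex_pure]

theorem Ex_mono {α : Type*} (μ : PMF α) {f g : α → ℝ≥0∞} (h : ∀ a, f a ≤ g a) :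
    Ex μ f ≤ Ex μ g :=
  ENNReal.tsum_le_tsum fun a => by gcongr; exact h a

theorem Ex_const {α : Type*} (μ : PMF α) (c : ℝ≥0∞) : Ex μ (fun _ => c) = c := by
  rw [Ex, ENNReal.tsum_mul_right, μ.tsum_coe, one_mul]

theorem Ex_le_of_le {α : Type*} (μ : PMF α) {f : α → ℝ≥0∞} {c : ℝ≥0∞} (h : ∀ a, f a ≤ c) :
    Ex μ f ≤ c :=
  (Ex_mono μ h).trans (Ex_const μ c).le

theorem Ex_add {α : Type*} (μ : PMF α) (f g : α → ℝ≥0∞) :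
    Ex μ (fun a => f a + g a) = Ex μ f + Ex μ g := by
  simp only [Ex, mul_add, ENNReal.tsum_add]

theorem Ex_mul_left {α : Type*} (μ : PMF α) (c : ℝ≥0∞) (f : α → ℝ≥0∞) :
    Ex μ (fun a => c * f a) = c * Ex μ f := by
  simp only [Ex, ← ENNReal.tsum_mul_left, mul_left_comm]

theorem Ex_mul_right {α : Type*} (μ : PMF α) (c : ℝ≥0∞) (f : α → ℝ≥0∞) :
    Ex μ (fun a => f a * c) = Ex μ f * c := by
  simp only [mul_comm _ c, Ex_mul_left]

theorem Ex_eq_indicator {α : Type*} [DecidableEq α] (μ : PMF α) (a : α) :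
    Ex μ (fun x => if x = a then 1 else 0) = μ a := by
  rw [Ex, tsum_eq_single a]
  · simp
  · intro b hb
    simp [hb]

theorem Ex_uniform_indicator {α : Type*} [Fintype α] [Nonempty α] (s : Finset α)
    [DecidablePred (· ∈ s)] :
    Ex (PMF.uniformOfFintype α) (fun x => if x ∈ s then 1 else 0) =
      (s.card : ℝ≥0∞) / Fintype.card α := by
  rw [Ex, tsum_fintype]
  simp [PMF.uniformOfFintype_apply, ← Finset.sum_filter, div_eq_mul_inv]

/-! ### Products of distributions -/

/-- The joint law of independent random variables with laws `μ i`. -/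
def piPMF {α : Type} : (m : ℕ) → (Fin m → PMF α) → PMF (Fin m → α)
  | 0, _ => PMF.pure Fin.elim0
  | m + 1, μ => (μ 0).bind fun a => (piPMF m fun i => μ i.succ).bind fun v =>
      PMF.pure (Fin.cons a v)

/-- Independence in the only form the proof needs; it factors the weights over the blocks and also
yields the point masses `piPMF_apply`. -/
theorem Ex_piPMF_prod {α : Type} : (m : ℕ) → (μ : Fin m → PMF α) → (f : Fin m → α → ℝ≥0∞) →
    Ex (piPMF m μ) (fun v => ∏ i, f i (v i)) = ∏ i, Ex (μ i) (f i)
  | 0, μ, f => by simp [Ex_const]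
  | m + 1, μ, f => by
    simp only [piPMF, Ex_bind, Ex_pure, Fin.prod_univ_succ, Fin.cons_zero, Fin.cons_succ,
      Ex_mul_left, Ex_piPMF_prod m (fun i => μ i.succ) (fun i => f i.succ), Ex_mul_right]

theorem piPMF_apply {α : Type} : (m : ℕ) → (μ : Fin m → PMF α) → (v : Fin m → α) →
    piPMF m μ v = ∏ i, μ i (v i) := by
  classical
  intro m μ v
  have h := Ex_piPMF_prod m μ fun i a => if a = v i then 1 else 0
  simp only [Ex_eq_indicator] at h
  rw [← h, ← Ex_eq_indicator]
  congr 1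
  funext x
  simp [Finset.prod_ite_zero, funext_iff]

/-! ### Laws and running times of randomized procedures -/

namespace Timed

/-- The result of `x` has law `μ`, whatever the number of steps spent before. -/
def HasDist {α : Type} (x : Timed α) (μ : PMF α) : Prop := ∀ t, (x.run t).map Prod.fst = μ

/-- `x` adds at most `T` to the number of steps. -/
def TimeBound {α : Type} (x : Timed α) (T : ℕ) : Prop :=
  ∀ t, ∀ a ∈ (x.run t).support, a.2 ≤ t + T

variable {α β : Type}

theorem HasDist.dist_eq {x : Timed α} {μ : PMF α} (h : HasDist x μ) : x.dist = μ := h 0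

theorem TimeBound.timeLE {x : Timed α} {T S : ℕ} (h : TimeBound x T) (hTS : T ≤ S) :
    x.TimeLE S := fun a ha => by
  have := h 0 a ha
  omega

theorem hasDist_pure (a : α) : HasDist (pure a) (PMF.pure a) := fun t =>
  PMF.pure_map Prod.fst (a, t)

theorem hasDist_tick (c : ℕ) : HasDist (tick c) (PMF.pure ()) := fun t =>
  PMF.pure_map Prod.fst ((), t + c)

theorem hasDist_draw (μ : PMF α) : HasDist (draw μ) μ := fun t => by
  change (μ.map fun a => (a, t)).map Prod.fst = μ
  rw [PMF.map_comp]
  exact PMF.map_id μ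

theorem HasDist.bind {x : Timed α} {f : α → Timed β} {μ : PMF α} {κ : α → PMF β}
    (hx : HasDist x μ) (hf : ∀ a, HasDist (f a) (κ a)) : HasDist (x >>= f) (μ.bind κ) := fun t => by
  change ((x.run t).bind fun p => (f p.1).run p.2).map Prod.fst = _
  rw [PMF.map_bind]
  simp only [hf _ _]
  rw [← hx t, PMF.bind_map]
  rfl

theorem hasDist_tick_bind (c : ℕ) {y : Timed β} {μ : PMF β} (h : HasDist y μ) :
    HasDist (tick c >>= fun _ => y) μ := by
  simpa using (hasDist_tick c).bind fun _ => h

theorem hasDist_sampleBits (m : ℕ) : HasDist (sampleBits m) (PMF.uniformOfFintype (Bits m)) :=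
  hasDist_tick_bind _ (hasDist_draw _)

theorem hasDist_eval {m n : ℕ} (C : Circuit m n) (x : Bits m) : HasDist (eval C x) (C.outDist x) :=
  hasDist_tick_bind _ (hasDist_draw _)

theorem hasDist_xorBits {m : ℕ} (x y : Bits m) :
    HasDist (xorBits x y) (PMF.pure fun j => xor (x j) (y j)) :=
  hasDist_tick_bind _ (hasDist_pure _)

theorem hasDist_eqBits {m : ℕ} (x y : Bits m) : HasDist (eqBits x y) (PMF.pure (decide (x = y))) :=
  hasDist_tick_bind _ (hasDist_pure _)

theorem hasDist_count {m : ℕ} (e : Bits m) :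
    HasDist (count e) (PMF.pure (Finset.univ.filter fun i => e i = true).card) :=
  hasDist_tick_bind _ (hasDist_pure _)

theorem hasDist_forFin : (m : ℕ) → (f : Fin m → Timed α) → (μ : Fin m → PMF α) →
    (∀ i, HasDist (f i) (μ i)) → HasDist (forFin m f) (piPMF m μ)
  | 0, _, _, _ => hasDist_pure _
  | m + 1, _, _, h => hasDist_tick_bind _ <| (h 0).bind fun _ =>
      (hasDist_forFin m _ _ fun i => h i.succ).bind fun _ => hasDist_pure _

theorem timeBound_pure (a : α) : TimeBound (pure a) 0 := fun t b hb => by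
  have : b = (a, t) := by simpa using (PMF.mem_support_pure_iff (a, t) b).mp hb
  simp [this]

theorem timeBound_tick (c : ℕ) : TimeBound (tick c) c := fun t b hb => by
  have : b = ((), t + c) := by simpa using (PMF.mem_support_pure_iff ((), t + c) b).mp hb
  simp [this]

theorem timeBound_draw (μ : PMF α) : TimeBound (draw μ) 0 := fun t b hb => by
  obtain ⟨a, -, rfl⟩ := (PMF.mem_support_map_iff (fun a => (a, t)) μ b).mp hb
  simp

theorem TimeBound.bind {x : Timed α} {f : α → Timed β} {T S : ℕ}
    (hx : TimeBound x T) (hf : ∀ a, TimeBound (f a) S) : TimeBound (x >>= f) (T + S) :=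
  fun t b hb => by
  obtain ⟨p, hp, hpb⟩ := (PMF.mem_support_bind_iff (x.run t) (fun p => (f p.1).run p.2) b).mp hb
  have h₁ := hx t p hp
  have h₂ := hf p.1 p.2 b hpb
  omega

theorem TimeBound.mono {x : Timed α} {T S : ℕ} (hx : TimeBound x T) (h : T ≤ S) :
    TimeBound x S := fun t b hb => (hx t b hb).trans (by omega)

theorem timeBound_sampleBits (m : ℕ) : TimeBound (sampleBits m) m :=
  (timeBound_tick m).bind fun _ => timeBound_draw _

theorem timeBound_eval {m n : ℕ} (C : Circuit m n) (x : Bits m) : TimeBound (eval C x) C.size :=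
  (timeBound_tick _).bind fun _ => timeBound_draw _

theorem timeBound_xorBits {m : ℕ} (x y : Bits m) : TimeBound (xorBits x y) m :=
  (timeBound_tick m).bind fun _ => timeBound_pure _

theorem timeBound_eqBits {m : ℕ} (x y : Bits m) : TimeBound (eqBits x y) m :=
  (timeBound_tick m).bind fun _ => timeBound_pure _

theorem timeBound_count {m : ℕ} (e : Bits m) : TimeBound (count e) m :=
  (timeBound_tick m).bind fun _ => timeBound_pure _

theorem timeBound_forFin {T : ℕ} : (m : ℕ) → (f : Fin m → Timed α) →
    (∀ i, TimeBound (f i) T) → TimeBound (forFin m f) (m * (T + 1))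
  | 0, _, _ => (timeBound_pure _).mono (Nat.zero_le _)
  | m + 1, _, h => TimeBound.mono ((timeBound_tick 1).bind fun _ => (h 0).bind fun _ =>
      (timeBound_forFin m _ fun i => h i.succ).bind fun _ => timeBound_pure _) (by ring_nf; rfl)

end Timed

/-! ### The procedures of the scheme -/

open Timed

/-- Exclusive or with `r` if `b` is set. -/
def maskBits {m : ℕ} (b : Bool) (r g : Bits m) : Bits m :=
  if b then fun j => xor (g j) (r j) else g

theorem maskBits_maskBits {m : ℕ} (b : Bool) (r g : Bits m) :
    maskBits b r (maskBits b r g) = g := by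
  cases b <;> simp [maskBits]

theorem maskBits_injective {m : ℕ} (b : Bool) (r : Bits m) : Function.Injective (maskBits b r) :=
  Function.LeftInverse.injective (maskBits_maskBits b r)

theorem hasDist_mask {m : ℕ} (b : Bool) (r g : Bits m) :
    HasDist (if b then Timed.xorBits g r else pure g) (PMF.pure (maskBits b r g)) := by
  cases b
  · exact hasDist_pure _
  · exact hasDist_xorBits _ _

theorem timeBound_mask {m : ℕ} (b : Bool) (r g : Bits m) :
    TimeBound (if b then Timed.xorBits g r else pure g) m := by
  cases b
  · exact (timeBound_pure _).mono (Nat.zero_le _)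
  · exact timeBound_xorBits _ _

/-- Matches the form of the conditional in `verify`, where the continuation sits inside both
branches. -/
theorem hasDist_mask_bind {β : Type} {m : ℕ} (b : Bool) (r g : Bits m) {f : Bits m → Timed β}
    {κ : Bits m → PMF β} (hf : ∀ z, HasDist (f z) (κ z)) :
    HasDist (if b then Timed.xorBits g r >>= f else pure g >>= f) (κ (maskBits b r g)) := by
  have h := (hasDist_mask b r g).bind hf
  rw [PMF.pure_bind] at h
  cases b <;> exact h

theorem timeBound_mask_bind {β : Type} {m T : ℕ} (b : Bool) (r g : Bits m) {f : Bits m → Timed β}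
    (hf : ∀ z, TimeBound (f z) T) :
    TimeBound (if b then Timed.xorBits g r >>= f else pure g >>= f) (m + T) := by
  have h := (timeBound_mask b r g).bind hf
  cases b <;> exact h

variable (G : ∀ n, Circuit n (3 * n))

theorem commit_dist (n : ℕ) (b : Bool) (r : Bits (3 * n)) :
    ((naorCommitment G).commit n b r).dist =
      (piPMF n fun _ => PMF.uniformOfFintype (Bits n)).bind fun k =>
        (piPMF n fun i => ((G n).outDist (k i)).map (maskBits b r)).bind fun y =>
          PMF.pure (concat y, (b, k)) :=
  ((hasDist_forFin n _ _ fun _ => hasDist_sampleBits n).bind fun k =>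
    (hasDist_forFin n _ _ fun i => (hasDist_eval (G n) (k i)).bind fun g =>
      hasDist_mask b r g).bind fun _ => hasDist_pure _).dist_eq

/-- The law of the receiver's list of comparisons. -/
def matchDist (n : ℕ) (r : Bits (3 * n)) (c : Bits (n * (3 * n))) (d : Bool × (Fin n → Bits n)) :
    PMF (Fin n → Bool) :=
  piPMF n fun i => ((G n).outDist (d.2 i)).map fun g => decide (block c i = maskBits d.1 r g)

theorem verify_dist (n : ℕ) (r : Bits (3 * n)) (c : Bits (n * (3 * n)))
    (d : Bool × (Fin n → Bits n)) :
    ((naorCommitment G).verify n r c d).dist =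
      (matchDist G n r c d).map fun e =>
        if 2 * n ≤ 3 * (Finset.univ.filter fun i => e i = true).card then some d.1 else none := by
  have h := ((hasDist_forFin n _ _ fun i => (hasDist_eval (G n) (d.2 i)).bind fun g =>
    hasDist_mask_bind d.1 r g fun z => hasDist_eqBits (block c i) z).bind fun e =>
      (hasDist_count e).bind fun N => hasDist_pure
        (if 2 * n ≤ 3 * N then some d.1 else none)).dist_eq
  refine h.trans ?_
  simp only [PMF.pure_bind]
  rfl

theorem challenge_dist (n : ℕ) :
    ((naorCommitment G).challenge n).dist = PMF.uniformOfFintype (Bits (3 * n)) :=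
  (hasDist_sampleBits _).dist_eq

theorem efficient_naorCommitment (hG : IsQPT G) : (naorCommitment G).Efficient := by
  obtain ⟨p, hp⟩ := hG
  -- One polynomial dominates all three procedures: the challenge, the sampling of seeds, a loop of
  -- evaluation, masking and comparison, and the count.
  refine ⟨3 * .X + .X * (.X + 1) + .X * (p + 3 * .X + 3 * .X + 1) + .X, fun n => ?_⟩
  have heval : (3 * .X + .X * (.X + 1) + .X * (p + 3 * .X + 3 * .X + 1) + .X :
      Polynomial ℕ).eval n =
      3 * n + n * (n + 1) + n * (p.eval n + 3 * n + 3 * n + 1) + n := by simp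
  rw [heval]
  refine ⟨(timeBound_sampleBits _).timeLE (by omega), fun b r => ?_, fun r c d => ?_⟩
  · refine TimeBound.timeLE (T := n * (n + 1) + (n * ((p.eval n + 3 * n) + 1) + 0))
      ((timeBound_forFin n _ fun _ => timeBound_sampleBits n).bind fun k =>
      (timeBound_forFin n _ fun i => ((timeBound_eval (G n) (k i)).mono (hp n)).bind fun g =>
        timeBound_mask b r g).bind fun _ => timeBound_pure _) ?_
    nlinarith
  · refine TimeBound.timeLE (T := n * (p.eval n + (3 * n + 3 * n) + 1) + (n + 0))
      ((timeBound_forFin n _ fun i => ((timeBound_eval (G n) (d.2 i)).mono (hp n)).bind fun g =>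
        timeBound_mask_bind d.1 r g fun z => timeBound_eqBits (block c i) z).bind fun e =>
      (timeBound_count e).bind fun _ => timeBound_pure _) ?_
    nlinarith

/-! ### Correctness -/

theorem block_concat {n m : ℕ} (y : Fin n → Bits m) (i : Fin n) : block (concat y) i = y i := by
  funext j
  simp [block, concat]

theorem negligible_geometric (C : ℝ) : Negligible fun n => C * (1 / 2) ^ n := by
  intro d
  have h := (tendsto_pow_const_mul_const_pow_of_abs_lt_one d
    (r := (1 / 2 : ℝ)) (by rw [abs_of_pos] <;> norm_num)).const_mul C
  rw [mul_zero] at h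
  exact h.congr fun n => by ring

/-- The complement rule, written as a sum to avoid truncated subtraction. -/
theorem Ex_ne_add {α : Type*} [DecidableEq α] (μ : PMF α) (a : α) :
    Ex μ (fun x => if x = a then 0 else 1) + μ a = 1 := by
  rw [← Ex_eq_indicator, ← Ex_add]
  conv_rhs => rw [← Ex_const μ 1]
  congr 1
  funext x
  split_ifs <;> simp

theorem prod_ite_weight {n : ℕ} (P : Fin n → Prop) [DecidablePred P] :
    ∏ i, (if P i then (64 : ℝ≥0∞) else 1) = 64 ^ (Finset.univ.filter P).card := by
  rw [← Finset.prod_filter, Finset.prod_const]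

/-- An exponential Markov inequality: the indicator of `n / 3 ≤ #P` is bounded by a product. -/
theorem one_le_prod_weight {n : ℕ} (P : Fin n → Prop) [DecidablePred P]
    (h : n ≤ 3 * (Finset.univ.filter P).card) :
    1 ≤ (∏ i, if P i then (64 : ℝ≥0∞) else 1) * (4 ^ n)⁻¹ := by
  rw [prod_ite_weight, ← div_eq_mul_inv, ENNReal.le_div_iff_mul_le (by simp) (by simp), one_mul]
  -- The weight is `64 = 4 ^ 3` because the threshold is one third of the blocks; base 4 beats an
  -- expected weight of 2 per block.
  calc (4 : ℝ≥0∞) ^ n ≤ 4 ^ (3 * (Finset.univ.filter P).card) :=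
        pow_le_pow_right₀ (by norm_num) h
    _ = 64 ^ (Finset.univ.filter P).card := by rw [pow_mul]; norm_num

theorem two_pow_mul_inv_four_pow (n : ℕ) : (2 : ℝ≥0∞) ^ n * (4 ^ n)⁻¹ = (2 ^ n)⁻¹ := by
  rw [show (4 : ℝ≥0∞) = 2 * 2 by norm_num, mul_pow, ENNReal.mul_inv (by simp) (by simp),
    ← mul_assoc, ENNReal.mul_inv_cancel (by simp) (by simp), one_mul]

/-- The expected weight of a comparison of two independent runs of a circuit on a random seed. -/
def mismatchWeight {m n : ℕ} (C : Circuit m n) : ℝ≥0∞ :=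
  Ex (PMF.uniformOfFintype (Bits m)) fun k => Ex (C.outDist k) fun y => Ex (C.outDist k) fun g =>
    if y = g then 1 else 64

/-- The receiver's verdict on its list of comparisons. -/
def verdict {n : ℕ} (b : Bool) (e : Fin n → Bool) : Option Bool :=
  if 2 * n ≤ 3 * (Finset.univ.filter fun i => e i = true).card then some b else none

theorem honestExp_eq (n : ℕ) (b : Bool) :
    (naorCommitment G).honestExp n b = (PMF.uniformOfFintype (Bits (3 * n))).bind fun r =>
      ((piPMF n fun _ => PMF.uniformOfFintype (Bits n)).bind fun k =>
        (piPMF n fun i => ((G n).outDist (k i)).map (maskBits b r)).bind fun y =>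
          PMF.pure (concat y, (b, k))).bind fun cd =>
        (matchDist G n r cd.1 cd.2).map (verdict cd.2.1) :=
  congr_arg₂ PMF.bind (challenge_dist G n) (funext fun r =>
    congr_arg₂ PMF.bind (commit_dist G n b r) (funext fun cd => verify_dist G n r cd.1 cd.2))

/-- For every fixed `r` the mask cancels in the comparisons, and the blocks use independent seeds
and runs. Hence the expected product of the mismatch weights is a power. -/
theorem honestExp_failure_le (n : ℕ) (b : Bool) :
    Ex ((naorCommitment G).honestExp n b) (fun o => if o = some b then 0 else 1) ≤
      mismatchWeight (G n) ^ n * (4 ^ n)⁻¹ := by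
  rw [honestExp_eq, Ex_bind]
  refine Ex_le_of_le _ fun r => ?_
  simp only [Ex_bind, Ex_pure, Ex_map]
  have hstep : ∀ e : Fin n → Bool,
      (if verdict b e = some b then (0 : ℝ≥0∞) else 1) ≤
      (∏ i, if ¬ (e i = true) then (64 : ℝ≥0∞) else 1) * (4 ^ n)⁻¹ := by
    intro e
    by_cases h : 2 * n ≤ 3 * (Finset.univ.filter fun i => e i = true).card
    · simp [verdict, h]
    -- Fewer than `2n / 3` matches leave more than `n / 3` mismatches.
    · have hcard := Finset.card_filter_add_card_filter_not (s := (Finset.univ : Finset (Fin n)))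
        (fun i => e i = true)
      rw [Finset.card_univ, Fintype.card_fin] at hcard
      simp only [verdict, h, if_false, reduceCtorEq]
      exact one_le_prod_weight (fun i => ¬ (e i = true)) (by omega)
  refine (Ex_mono _ fun k => Ex_mono _ fun y => Ex_mono _ hstep).trans ?_
  simp only [Ex_mul_right]
  gcongr
  simp only [matchDist, Ex_piPMF_prod n _ (fun _ e => if ¬ (e = true) then (64 : ℝ≥0∞) else 1),
    block_concat, Ex_map]
  have hk : ∀ k : Fin n → Bits n,
      Ex (piPMF n fun i => ((G n).outDist (k i)).map (maskBits b r)) (fun y =>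
        ∏ i, Ex ((G n).outDist (k i)) fun g =>
          if ¬ (decide (y i = maskBits b r g) = true) then (64 : ℝ≥0∞) else 1) =
      ∏ i, Ex ((G n).outDist (k i)) fun y => Ex ((G n).outDist (k i)) fun g =>
        if y = g then 1 else 64 := by
    intro k
    rw [Ex_piPMF_prod n _ (fun i y => Ex ((G n).outDist (k i)) fun g =>
          if ¬ (decide (y = maskBits b r g) = true) then (64 : ℝ≥0∞) else 1)]
    simp only [Ex_map, decide_eq_true_eq, (maskBits_injective b r).eq_iff, ite_not]
  simp only [hk]
  rw [Ex_piPMF_prod n _ (fun _ k => Ex ((G n).outDist k) fun y => Ex ((G n).outDist k) fun g =>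
        if y = g then 1 else 64)]
  simp [mismatchWeight]

theorem one_sub_le_of_toReal {p : ℝ≥0∞} (hp : p ≤ 1) {δ : ℝ} (hδ : 0 ≤ δ)
    (h : 1 - δ ≤ p.toReal) : 1 ≤ p + ENNReal.ofReal δ := by
  have hp' : p ≠ ⊤ := (hp.trans_lt ENNReal.one_lt_top).ne
  rw [← ENNReal.ofReal_toReal hp', ← ENNReal.ofReal_add ENNReal.toReal_nonneg hδ,
    ← ENNReal.ofReal_one]
  exact ENNReal.ofReal_le_ofReal (by linarith)

/-- Two runs differ only if the seed is outside `K` or one of the runs misses the likely output of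
the seed. These three events have probability at most `δ` each and cost at most 64 each. -/
theorem mismatchWeight_le {m n : ℕ} (C : Circuit m n) {δ : ℝ} (hδ : 0 ≤ δ) (K : Finset (Bits m))
    (hK : 1 - δ ≤ (K.card : ℝ) / 2 ^ m)
    (hC : ∀ k ∈ K, ∃ y : Bits n, 1 - δ ≤ (C.outDist k y).toReal) :
    mismatchWeight C ≤ 1 + 64 * (3 * ENNReal.ofReal δ) := by
  have hfail : ∀ {α : Type} [DecidableEq α] (μ : PMF α) (a : α), 1 - δ ≤ (μ a).toReal →
      Ex μ (fun x => if x = a then 0 else 1) ≤ ENNReal.ofReal δ := by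
    intro α _ μ a h
    have h₁ := one_sub_le_of_toReal (μ.coe_le_one a) hδ h
    rw [← Ex_ne_add μ a, add_comm] at h₁
    exact (ENNReal.add_le_add_iff_left (μ.apply_ne_top a)).mp h₁
  have hgood : ∀ k ∈ K, (Ex (C.outDist k) fun y => Ex (C.outDist k) fun g =>
      if y = g then (1 : ℝ≥0∞) else 64) ≤ 1 + 64 * (2 * ENNReal.ofReal δ) := by
    intro k hk
    obtain ⟨z, hz⟩ := hC k hk
    have hle : ∀ y g : Bits n, (if y = g then (1 : ℝ≥0∞) else 64) ≤
        1 + 64 * ((if y = z then 0 else 1) + (if g = z then 0 else 1)) := by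
      intro y g
      by_cases hyg : y = g
      · rw [if_pos hyg]
        exact le_self_add
      · rw [if_neg hyg]
        have : (1 : ℝ≥0∞) ≤ (if y = z then 0 else 1) + (if g = z then 0 else 1) := by
          by_cases hy : y = z
          · have hg : g ≠ z := fun h => hyg (hy.trans h.symm)
            simp [hg]
          · simp [hy]
        calc (64 : ℝ≥0∞) = 64 * 1 := by simp
          _ ≤ 64 * ((if y = z then 0 else 1) + (if g = z then 0 else 1)) := by gcongr
          _ ≤ _ := le_add_self
    refine (Ex_mono _ fun y => Ex_mono _ fun g => hle y g).trans ?_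
    simp only [Ex_add, Ex_mul_left, Ex_const]
    rw [two_mul]
    gcongr <;> exact hfail _ _ hz
  have hall : ∀ k, (Ex (C.outDist k) fun y => Ex (C.outDist k) fun g =>
      if y = g then (1 : ℝ≥0∞) else 64) ≤
      (1 + 64 * (2 * ENNReal.ofReal δ)) + 64 * (if k ∈ K then 0 else 1) := by
    intro k
    by_cases hk : k ∈ K
    · exact (hgood k hk).trans le_self_add
    · simp only [hk, if_false, mul_one]
      refine (Ex_le_of_le _ fun y => Ex_le_of_le _ fun g => ?_).trans le_add_self
      split_ifs <;> norm_num
  refine (Ex_mono _ hall).trans ?_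
  simp only [Ex_add, Ex_mul_left, Ex_const]
  have hbad : Ex (PMF.uniformOfFintype (Bits m)) (fun k => if k ∈ K then 0 else 1) ≤
      ENNReal.ofReal δ := by
    have hpr : Ex (PMF.uniformOfFintype (Bits m)) (fun k => if k ∈ K then 0 else 1) +
        (K.card : ℝ≥0∞) / Fintype.card (Bits m) = 1 := by
      rw [← Ex_uniform_indicator, ← Ex_add]
      conv_rhs => rw [← Ex_const (PMF.uniformOfFintype (Bits m)) 1]
      congr 1
      funext x
      split_ifs <;> simp
    have hle : (K.card : ℝ≥0∞) / Fintype.card (Bits m) ≤ 1 := hpr ▸ le_add_self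
    have h₁ := one_sub_le_of_toReal hle hδ (by simpa using hK)
    rw [← hpr, add_comm] at h₁
    exact (ENNReal.add_le_add_iff_left (hle.trans_lt ENNReal.one_lt_top).ne).mp h₁
  calc _ ≤ 1 + 64 * (2 * ENNReal.ofReal δ) + 64 * ENNReal.ofReal δ := by gcongr
    _ = _ := by ring

theorem correct_naorCommitment (hG : ∃ c : ℝ, 0 < c ∧ ∃ μ : ℕ → ℝ,
    (μ =O[atTop] fun n : ℕ => (n : ℝ) ^ (-c)) ∧ Pseudodeterministic G μ) :
    (naorCommitment G).Correct := by
  obtain ⟨c, hc, μ, hμ, hps⟩ := hG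
  have hμ0 : Tendsto μ atTop (nhds 0) := hμ.trans_tendsto
    ((tendsto_rpow_neg_atTop hc).comp tendsto_natCast_atTop_atTop)
  -- The threshold `1 / 192 = 1 / (64 * 3)` makes the expected weight per block at most 2. Since `μ`
  -- tends to 0, the trivial error 1 is used for finitely many `n` only.
  refine ⟨fun n => if μ n ≤ 1 / 192 then 1 * (1 / 2) ^ n else 1, ?_, fun n b => ?_⟩
  · refine (negligible_geometric 1).congr' ?_
    filter_upwards [hμ0.eventually (gt_mem_nhds (show (0 : ℝ) < 1 / 192 by norm_num))] with n hn
    rw [if_pos hn.le]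
  · dsimp only
    split_ifs with h
    · obtain ⟨K, hK, hKG⟩ := hps n
      have hw : mismatchWeight (G n) ≤ 2 := by
        refine (mismatchWeight_le (G n) (δ := 1 / 192) (by norm_num) K (by linarith)
          fun k hk => ?_).trans ?_
        · obtain ⟨y, hy⟩ := hKG k hk
          exact ⟨y, by linarith⟩
        · rw [show (64 : ℝ≥0∞) = ENNReal.ofReal 64 by simp,
            show (3 : ℝ≥0∞) = ENNReal.ofReal 3 by simp,
            ← ENNReal.ofReal_mul (by norm_num), ← ENNReal.ofReal_mul (by norm_num)]
          norm_num
      have hfail : Ex ((naorCommitment G).honestExp n b) (fun o => if o = some b then 0 else 1) ≤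
          (2 ^ n)⁻¹ := by
        refine (honestExp_failure_le G n b).trans ?_
        rw [← two_pow_mul_inv_four_pow]
        gcongr
      have hsum := Ex_ne_add ((naorCommitment G).honestExp n b) (some b)
      have hle : (1 : ℝ≥0∞) ≤ (2 ^ n)⁻¹ + (naorCommitment G).honestExp n b (some b) := by
        rw [← hsum]
        gcongr
      have hne := ((naorCommitment G).honestExp n b).apply_ne_top (some b)
      have hr := ENNReal.toReal_mono (ENNReal.add_ne_top.mpr ⟨by simp, hne⟩) hle
      rw [ENNReal.toReal_add (by simp) hne] at hr
      simp only [ENNReal.toReal_one, ENNReal.toReal_inv, ENNReal.toReal_pow,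
        ENNReal.toReal_ofNat] at hr
      rw [one_mul, one_div, inv_pow]
      linarith
    · simp

/-! ### Binding -/

/-- The seeds and outputs for which the output has probability more than `1 / 64`. -/
def heavyPairs {m n : ℕ} (C : Circuit m n) : Finset (Bits m × Bits n) :=
  Finset.univ.filter fun p => 1 < 64 * C.outDist p.1 p.2

/-- For each seed the output probabilities sum to 1, so at most 64 of them can exceed `1 / 64`. -/
theorem card_heavyPairs_le {m n : ℕ} (C : Circuit m n) : (heavyPairs C).card ≤ 64 * 2 ^ m := by
  have h : ((heavyPairs C).card : ℝ≥0∞) ≤ 64 * 2 ^ m := by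
    calc ((heavyPairs C).card : ℝ≥0∞) = ∑ p ∈ heavyPairs C, 1 := by simp
      _ ≤ ∑ p ∈ heavyPairs C, 64 * C.outDist p.1 p.2 :=
        Finset.sum_le_sum fun p hp => (Finset.mem_filter.mp hp).2.le
      _ ≤ ∑ p : Bits m × Bits n, 64 * C.outDist p.1 p.2 :=
        Finset.sum_le_sum_of_subset (Finset.subset_univ _)
      _ = 64 * 2 ^ m := by
        rw [← Finset.mul_sum, Fintype.sum_prod_type]
        have : ∀ k, ∑ y, C.outDist k y = 1 := fun k => by
          rw [← tsum_fintype (L := .unconditional _)]; exact (C.outDist k).tsum_coe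
        simp [this]
  exact_mod_cast h

/-- The receiver's messages for which a commitment can be opened in two ways. -/
def badChallenges {m n : ℕ} (C : Circuit m n) : Finset (Bits n) :=
  (heavyPairs C ×ˢ heavyPairs C).image fun p j => xor (p.1.2 j) (p.2.2 j)

theorem card_badChallenges_le {m n : ℕ} (C : Circuit m n) :
    (badChallenges C).card ≤ 4096 * 2 ^ m * 2 ^ m := by
  refine Finset.card_image_le.trans ?_
  rw [Finset.card_product]
  calc _ ≤ (64 * 2 ^ m) * (64 * 2 ^ m) := Nat.mul_le_mul (card_heavyPairs_le C) (card_heavyPairs_le C)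
    _ = _ := by ring

/-- If a product of two probabilities exceeds `1 / 64`, so does each factor. Then `y` and `y ⊕ r`
are both heavy, and their exclusive or `r` is a bad challenge. -/
theorem outDist_mul_le {m n : ℕ} (C : Circuit m n) {r : Bits n} (hr : r ∉ badChallenges C)
    (k k' : Bits m) (y : Bits n) :
    64 * (C.outDist k y * C.outDist k' (maskBits true r y)) ≤ 1 := by
  by_contra! h
  refine hr (Finset.mem_image.mpr ⟨((k, y), (k', maskBits true r y)), ?_, ?_⟩)
  · simp only [heavyPairs, Finset.mem_product, Finset.mem_filter, Finset.mem_univ, true_and]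
    constructor
    · refine h.trans_le ?_
      gcongr
      exact mul_le_of_le_one_right' ((C.outDist k').coe_le_one _)
    · refine h.trans_le ?_
      gcongr
      exact mul_le_of_le_one_left' ((C.outDist k).coe_le_one _)
  · funext j
    simp [maskBits]

theorem bindingExp_eq (n : ℕ) (C : Bits (3 * n) →
      PMF (Bits (n * (3 * n)) × (Bool × (Fin n → Bits n)) × (Bool × (Fin n → Bits n)))) :
    (naorCommitment G).bindingExp n C = (PMF.uniformOfFintype (Bits (3 * n))).bind fun r =>
      (C r).bind fun m => ((matchDist G n r m.1 m.2.1).map (verdict m.2.1.1)).bind fun v₀ =>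
        ((matchDist G n r m.1 m.2.2).map (verdict m.2.2.1)).bind fun v₁ =>
          PMF.pure (decide (v₀ = some false) && decide (v₁ = some true)) :=
  congr_arg₂ PMF.bind (challenge_dist G n) (funext fun r =>
    congr_arg (PMF.bind (C r)) (funext fun m =>
      congr_arg₂ PMF.bind (verify_dist G n r m.1 m.2.1) (funext fun v₀ =>
        congr_arg (PMF.bind · fun v₁ =>
          PMF.pure (decide (v₀ = some false) && decide (v₁ = some true)))
          (verify_dist G n r m.1 m.2.2))))

/-- The two checks are independent of each other and across blocks, so the expectation factors. A
block contributes at most 1 plus 64 times the probability of a double match, hence at most 2 by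
`outDist_mul_le`. -/
theorem two_openings_le {n : ℕ} {r : Bits (3 * n)} (hr : r ∉ badChallenges (G n))
    (c : Bits (n * (3 * n))) (k k' : Fin n → Bits n) :
    (Ex (matchDist G n r c (false, k)) fun e => Ex (matchDist G n r c (true, k')) fun e' =>
      ∏ i, if e i = true ∧ e' i = true then (64 : ℝ≥0∞) else 1) ≤ 2 ^ n := by
  have h₁ : ∀ e : Fin n → Bool, Ex (matchDist G n r c (true, k')) (fun e' =>
      ∏ i, if e i = true ∧ e' i = true then (64 : ℝ≥0∞) else 1) = ∏ i, Ex ((G n).outDist (k' i))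
        fun g => if e i = true ∧ block c i = maskBits true r g then (64 : ℝ≥0∞) else 1 := by
    intro e
    rw [matchDist,
      Ex_piPMF_prod n _ (fun i e' => if e i = true ∧ e' = true then (64 : ℝ≥0∞) else 1)]
    simp only [Ex_map, decide_eq_true_eq]
  simp only [h₁]
  rw [matchDist, Ex_piPMF_prod n _ (fun i e => Ex ((G n).outDist (k' i))
        fun g => if e = true ∧ block c i = maskBits true r g then (64 : ℝ≥0∞) else 1)]
  simp only [Ex_map, decide_eq_true_eq]
  refine (Finset.prod_le_pow_card _ _ 2 fun i _ => ?_).trans (by simp)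
  -- A double match pins down both outputs: the first run must give the block itself, the second the
  -- block masked by `r`.
  have hpt : ∀ g g' : Bits (3 * n),
      (if block c i = maskBits false r g ∧ block c i = maskBits true r g' then (64 : ℝ≥0∞) else 1) ≤
      1 + 64 * ((if g = block c i then 1 else 0) *
        (if g' = maskBits true r (block c i) then 1 else 0)) := by
    intro g g'
    split_ifs with h ha hb <;> try simp
    · exact hb (by rw [h.2, maskBits_maskBits])
    all_goals exact ha h.1.symm
  refine (Ex_mono _ fun g => Ex_mono _ fun g' => hpt g g').trans ?_
  simp only [Ex_add, Ex_mul_left, Ex_mul_right, Ex_const, Ex_eq_indicator]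
  calc _ ≤ (1 : ℝ≥0∞) + 1 := by gcongr; exact outDist_mul_le (G n) hr _ _ _
    _ = 2 := one_add_one_eq_two

theorem two_verify_le {n : ℕ} {r : Bits (3 * n)} (hr : r ∉ badChallenges (G n))
    (c : Bits (n * (3 * n))) (d d' : Bool × (Fin n → Bits n)) :
    (Ex (matchDist G n r c d) fun e => Ex (matchDist G n r c d') fun e' =>
      if (decide (verdict d.1 e = some false) &&
        decide (verdict d'.1 e' = some true)) = true
      then (1 : ℝ≥0∞) else 0) ≤ (2 ^ n)⁻¹ := by
  obtain ⟨b, k⟩ := d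
  obtain ⟨b', k'⟩ := d'
  -- A verdict is the claimed bit or a rejection, so other claimed bits can never produce the
  -- outputs 0 and 1.
  by_cases hb : b = false ∧ b' = true
  · obtain ⟨rfl, rfl⟩ := hb
    have hpt : ∀ e e' : Fin n → Bool,
        (if (decide (verdict false e = some false) &&
          decide (verdict true e' = some true)) = true
        then (1 : ℝ≥0∞) else 0) ≤
        (∏ i, if e i = true ∧ e' i = true then (64 : ℝ≥0∞) else 1) * (4 ^ n)⁻¹ := by
      intro e e'
      by_cases h : 2 * n ≤ 3 * (Finset.univ.filter fun i => e i = true).card ∧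
          2 * n ≤ 3 * (Finset.univ.filter fun i => e' i = true).card
      · simp only [verdict, h.1, h.2, if_true, decide_true, Bool.and_self]
        refine one_le_prod_weight (fun i => e i = true ∧ e' i = true) ?_
        -- Inclusion-exclusion: `2n / 3 + 2n / 3 - n = n / 3` blocks match both openings.
        have hcard := Finset.card_union_add_card_inter
          (Finset.univ.filter fun i => e i = true) (Finset.univ.filter fun i => e' i = true)
        have hle := Finset.card_le_univ
          ((Finset.univ.filter fun i => e i = true) ∪ (Finset.univ.filter fun i => e' i = true))
        rw [← Finset.filter_and] at hcard
        rw [Fintype.card_fin] at hle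
        omega
      · rw [if_neg]
        · exact zero_le
        · simpa [verdict] using h
    refine (Ex_mono _ fun e => Ex_mono _ fun e' => hpt e e').trans ?_
    simp only [Ex_mul_right]
    rw [← two_pow_mul_inv_four_pow]
    gcongr
    exact two_openings_le G hr c k k'
  · refine Ex_le_of_le _ fun e => Ex_le_of_le _ fun e' => ?_
    rw [if_neg]
    · exact zero_le
    · intro h
      apply hb
      simp only [verdict, Bool.and_eq_true, decide_eq_true_eq] at h
      constructor
      · have := h.1
        split_ifs at this
        simpa using this
      · have := h.2
        split_ifs at this
        simpa using this

theorem bindingExp_true_le (n : ℕ) (C : Bits (3 * n) →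
      PMF (Bits (n * (3 * n)) × (Bool × (Fin n → Bits n)) × (Bool × (Fin n → Bits n)))) :
    (naorCommitment G).bindingExp n C true ≤ 4097 * (2 ^ n)⁻¹ := by
  rw [← Ex_eq_indicator]
  rw [bindingExp_eq]
  simp only [Ex_bind, Ex_pure, Ex_map]
  have hr : ∀ r : Bits (3 * n), (Ex (C r) fun m =>
      Ex (matchDist G n r m.1 m.2.1) fun e => Ex (matchDist G n r m.1 m.2.2) fun e' =>
      if (decide (verdict m.2.1.1 e = some false) &&
        decide (verdict m.2.2.1 e' = some true)) = true
      then (1 : ℝ≥0∞) else 0) ≤ (if r ∈ badChallenges (G n) then 1 else 0) + (2 ^ n)⁻¹ := by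
    intro r
    by_cases hr : r ∈ badChallenges (G n)
    · simp only [hr, if_true]
      refine (Ex_le_of_le _ fun m => Ex_le_of_le _ fun e => Ex_le_of_le _ fun e' => ?_).trans
        le_self_add
      split_ifs <;> simp
    · simp only [hr, if_false, zero_add]
      exact Ex_le_of_le _ fun m => two_verify_le G hr m.1 m.2.1 m.2.2
  refine (Ex_mono _ hr).trans ?_
  rw [Ex_add, Ex_const, Ex_uniform_indicator]
  -- The output length `3 * n` is used here: `4 ^ n` pairs of seeds are compared with `8 ^ n`
  -- challenges.
  have hbad : ((badChallenges (G n)).card : ℝ≥0∞) / Fintype.card (Bits (3 * n)) ≤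
      4096 * (2 ^ n)⁻¹ := by
    have h₁ : ((badChallenges (G n)).card : ℝ≥0∞) ≤ 4096 * 2 ^ n * 2 ^ n := by
      exact_mod_cast card_badChallenges_le (G n)
    refine ENNReal.div_le_of_le_mul (h₁.trans (le_of_eq ?_))
    have h₂ : (Fintype.card (Bits (3 * n)) : ℝ≥0∞) = 2 ^ n * (2 ^ n * 2 ^ n) := by
      simp only [Fintype.card_fun, Fintype.card_bool, Fintype.card_fin]
      push_cast
      ring
    rw [h₂, mul_assoc 4096, mul_assoc 4096, ← mul_assoc (2 ^ n)⁻¹,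
      ENNReal.inv_mul_cancel (by simp) (by simp), one_mul]
  calc _ ≤ (4096 : ℝ≥0∞) * (2 ^ n)⁻¹ + (2 ^ n)⁻¹ := by gcongr
    _ = 4097 * (2 ^ n)⁻¹ := by ring

theorem binding_naorCommitment : (naorCommitment G).StatisticallyBinding := by
  refine ⟨fun n => 4097 * (1 / 2) ^ n, negligible_geometric _, fun n C => ?_⟩
  have h := ENNReal.toReal_mono (ENNReal.mul_ne_top (by simp) (by simp)) (bindingExp_true_le G n C)
  simpa using h

/-! ### Circuits that first add a classical string to some of their inputs -/

/-- Flip the bits of `u` at the positions `e i` with `y i = 1`. -/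
def flipBits {q m : ℕ} (e : Fin q ↪ Fin m) (y : Bits q) (u : Bits m) : Bits m := fun p =>
  xor (u p) (Function.extend e y (fun _ => false) p)

theorem flipBits_apply {q m : ℕ} (e : Fin q ↪ Fin m) (y : Bits q) (u : Bits m) (i : Fin q) :
    flipBits e y u (e i) = xor (u (e i)) (y i) := by
  rw [flipBits, e.injective.extend_apply]

theorem flipBits_of_notMem {q m : ℕ} (e : Fin q ↪ Fin m) (y : Bits q) (u : Bits m) {p : Fin m}
    (hp : ∀ i, e i ≠ p) : flipBits e y u p = u p := by
  rw [flipBits, Function.extend_apply' _ _ _ (by simpa using hp), Bool.xor_false]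

theorem flipBits_flipBits {q m : ℕ} (e : Fin q ↪ Fin m) (y : Bits q) (u : Bits m) :
    flipBits e y (flipBits e y u) = u := by
  funext p
  simp [flipBits]

theorem flipBits_involutive {q m : ℕ} (e : Fin q ↪ Fin m) (y : Bits q) :
    Function.Involutive (flipBits e y) := flipBits_flipBits e y

/-- The matrix of a map between basis labels. -/
def funMat {m n : ℕ} (φ : Bits m → Bits n) : Matrix (Bits n) (Bits m) ℂ :=
  Matrix.of fun x u => if x = φ u then 1 else 0

theorem cnot_mul_funMat {m w : ℕ} (c t : Fin w) (h : c ≠ t) (φ : Bits m → Bits w) :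
    (Gate.CNOT c t h).mat * funMat φ =
      funMat fun u => Function.update (φ u) t (xor (φ u t) (φ u c)) := by
  ext x u
  simp [Matrix.mul_apply, Gate.mat, funMat]

/-- The same gate, with `q` additional wires in front. -/
def Gate.shift (q : ℕ) {w : ℕ} : Gate w → Gate (q + w)
  | .H i => .H (Fin.natAdd q i)
  | .T i => .T (Fin.natAdd q i)
  | .CNOT c t h => .CNOT (Fin.natAdd q c) (Fin.natAdd q t)
      fun h' => h ((Fin.natAddEmb q).injective h')

/-! ### Registers split into `q` front wires and `w` back wires -/

theorem append_inj {q w : ℕ} {y₁ y₂ : Bits q} {x₁ x₂ : Bits w} :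
    Fin.append y₁ x₁ = Fin.append y₂ x₂ ↔ y₁ = y₂ ∧ x₁ = x₂ := by
  rw [← Prod.mk.injEq]
  exact (Fin.appendEquiv q w).injective.eq_iff (a := (y₁, x₁)) (b := (y₂, x₂))

theorem update_append_natAdd {q w : ℕ} (y : Bits q) (x : Bits w) (i : Fin w) (b : Bool) :
    Function.update (Fin.append y x) (Fin.natAdd q i) b = Fin.append y (Function.update x i b) := by
  funext j
  induction j using Fin.addCases with
  | left j =>
    rw [Function.update_of_ne, Fin.append_left, Fin.append_left]
    intro h
    simpa using (Fin.ext_iff.mp h).trans_ge (Nat.le_add_right q i) |>.not_gt j.isLt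
  | right j =>
    rw [Fin.append_right]
    by_cases h : j = i
    · subst h
      simp
    · rw [Function.update_of_ne h, Function.update_of_ne, Fin.append_right]
      exact fun h' => h ((Fin.natAddEmb q).injective h')

theorem Gate.shift_mat (q : ℕ) {w : ℕ} (g : Gate w) (y₁ y₂ : Bits q) (x₁ x₂ : Bits w) :
    (g.shift q).mat (Fin.append y₁ x₁) (Fin.append y₂ x₂) = if y₁ = y₂ then g.mat x₁ x₂ else 0 := by
  cases g with
  | H i =>
    have h : (∀ j, j ≠ Fin.natAdd q i → Fin.append y₁ x₁ j = Fin.append y₂ x₂ j) ↔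
        y₁ = y₂ ∧ ∀ j, j ≠ i → x₁ j = x₂ j := by
      constructor
      · refine fun h => ⟨funext fun j => ?_, fun j hj => ?_⟩
        · have := h (Fin.castAdd w j) fun h' => by
            have := Fin.ext_iff.mp h'
            have := j.isLt
            simp only [Fin.val_castAdd, Fin.val_natAdd] at *
            omega
          simpa using this
        · simpa using h (Fin.natAdd q j) fun h' => hj ((Fin.natAddEmb q).injective h')
      · rintro ⟨rfl, h⟩ j hj
        induction j using Fin.addCases with
        | left j => simp
        | right j => simpa using h j fun h' => hj (by rw [h'])
    simp only [Gate.shift, Gate.mat, Matrix.of_apply, h, Fin.append_right, ite_and]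
  | T i =>
    simp only [Gate.shift, Gate.mat, Matrix.diagonal_apply, append_inj, Fin.append_right, ite_and]
  | CNOT c t h =>
    simp only [Gate.shift, Gate.mat, Matrix.of_apply, Fin.append_right, update_append_natAdd,
      append_inj, ite_and]

/-- Starting the fold from the initialization isometry lets the CNOT layer and the shifted circuit
be analysed one after the other. -/
theorem foldl_gates_mul {m w : ℕ} (l : List (Gate w)) (U : Op w) (B : Matrix (Bits w) (Bits m) ℂ) :
    l.foldl (fun U g => g.mat * U) U * B = l.foldl (fun U g => g.mat * U) (U * B) := by
  induction l generalizing U with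
  | nil => rfl
  | cons g l ih => rw [List.foldl_cons, List.foldl_cons, ih, Matrix.mul_assoc]

theorem sum_append {q w : ℕ} {M : Type*} [AddCommMonoid M] (f : Bits (q + w) → M) :
    ∑ x, f x = ∑ y, ∑ x, f (Fin.append y x) := by
  rw [← (Fin.appendEquiv q w).sum_comp, Fintype.sum_prod_type]
  rfl

/-- Gates on the last wires preserve the form of a matrix that is block diagonal with respect to
the first wires. -/
theorem foldl_shift {q m w : ℕ} (l : List (Gate w)) (B : Matrix (Bits (q + w)) (Bits (q + m)) ℂ)
    (B₀ : Matrix (Bits w) (Bits m) ℂ) (φ : Bits q → Bits m → Bits m)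
    (hB : ∀ y' x y u, B (Fin.append y' x) (Fin.append y u) = if y' = y then B₀ x (φ y u) else 0)
    (y' : Bits q) (x : Bits w) (y : Bits q) (u : Bits m) :
    (l.map (Gate.shift q)).foldl (fun U g => g.mat * U) B (Fin.append y' x) (Fin.append y u) =
      if y' = y then l.foldl (fun U g => g.mat * U) B₀ x (φ y u) else 0 := by
  induction l generalizing B B₀ with
  | nil => exact hB y' x y u
  | cons g l ih =>
    refine ih _ (g.mat * B₀) fun y' x y u => ?_
    change ((g.shift q).mat * B) _ _ = _
    rw [Matrix.mul_apply, sum_append]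
    simp only [Gate.shift_mat, hB]
    rw [Finset.sum_eq_single y']
    · by_cases h : y' = y <;> simp [h, Matrix.mul_apply]
    · intro z _ hz
      simp [hz.symm]
    · simp

/-- A list of controlled negations, as a map of basis labels. -/
def cnotFold {q w : ℕ} (c t : Fin q → Fin w) (l : List (Fin q)) (X : Bits w) : Bits w :=
  l.foldl (fun X i => Function.update X (t i) (xor (X (t i)) (X (c i)))) X

theorem foldl_cnot_funMat {q m w : ℕ} (c t : Fin q → Fin w) (h : ∀ i, c i ≠ t i)
    (l : List (Fin q)) (φ : Bits m → Bits w) :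
    (l.map fun i => Gate.CNOT (c i) (t i) (h i)).foldl (fun U g => g.mat * U) (funMat φ) =
      funMat fun u => cnotFold c t l (φ u) := by
  induction l generalizing φ with
  | nil => rfl
  | cons i l ih =>
    rw [List.map_cons, List.foldl_cons, cnot_mul_funMat, ih]
    rfl

theorem cnotFold_of_notMem {q w : ℕ} (c t : Fin q → Fin w) (l : List (Fin q)) (X : Bits w)
    (j : Fin w) (hj : ∀ i ∈ l, t i ≠ j) : cnotFold c t l X j = X j := by
  induction l generalizing X with
  | nil => rfl
  | cons i l ih =>
    refine (ih _ fun i' hi' => hj i' (List.mem_cons_of_mem _ hi')).trans ?_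
    dsimp only
    rw [Function.update_of_ne (hj i List.mem_cons_self).symm]

/-- No control is a target and every target is hit once, so each gate reads the original bits. -/
theorem cnotFold_of_mem {q w : ℕ} (c t : Fin q → Fin w) (ht : Function.Injective t)
    (hct : ∀ i i', c i ≠ t i') (l : List (Fin q)) (hl : l.Nodup) (X : Bits w)
    (i : Fin q) (hi : i ∈ l) : cnotFold c t l X (t i) = xor (X (t i)) (X (c i)) := by
  induction l generalizing X with
  | nil => simp at hi
  | cons a l ih =>
    rw [List.nodup_cons] at hl
    by_cases h : i = a
    · subst h
      refine (cnotFold_of_notMem c t l _ (t i) fun i' hi' h' => ?_).trans (by simp)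
      exact hl.1 (ht h' ▸ hi')
    · refine (ih hl.2 _ ((List.mem_cons.mp hi).resolve_left h)).trans ?_
      dsimp only
      rw [Function.update_of_ne fun h' => h (ht h'), Function.update_of_ne (hct i a)]

theorem castAdd_ne_natAdd {q w : ℕ} (i : Fin q) (j : Fin w) : Fin.castAdd w i ≠ Fin.natAdd q j :=
  fun h => by
  have h₁ := Fin.ext_iff.mp h
  have h₂ := i.isLt
  simp only [Fin.val_castAdd, Fin.val_natAdd] at h₁
  omega

/-- The input wires after adding `q` wires in front, all of which are inputs. -/
def extendInputs (q : ℕ) {m w : ℕ} (f : Fin m ↪ Fin w) : Fin (q + m) ↪ Fin (q + w) where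
  toFun := fun k => Fin.addCases (motive := fun _ => Fin (q + w)) (Fin.castAdd w)
    (fun i => Fin.natAdd q (f i)) k
  inj' := by
    intro i j h
    induction i using Fin.addCases with
    | left i =>
      induction j using Fin.addCases with
      | left j => simpa using h
      | right j => exact absurd (by simpa using h) (castAdd_ne_natAdd i (f j))
    | right i =>
      induction j using Fin.addCases with
      | left j => exact absurd (by simpa using h.symm) (castAdd_ne_natAdd j (f i))
      | right j => simpa using h

theorem extendInputs_apply (q : ℕ) {m w : ℕ} (f : Fin m ↪ Fin w) (k : Fin (q + m)) :
    extendInputs q f k = Fin.addCases (motive := fun _ => Fin (q + w)) (Fin.castAdd w)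
      (fun i => Fin.natAdd q (f i)) k := rfl

theorem extendInputs_castAdd (q : ℕ) {m w : ℕ} (f : Fin m ↪ Fin w) (i : Fin q) :
    extendInputs q f (Fin.castAdd m i) = Fin.castAdd w i := by
  rw [extendInputs_apply, Fin.addCases_left]

theorem extendInputs_natAdd (q : ℕ) {m w : ℕ} (f : Fin m ↪ Fin w) (i : Fin m) :
    extendInputs q f (Fin.natAdd q i) = Fin.natAdd q (f i) := by
  rw [extendInputs_apply, Fin.addCases_right]

theorem extend_extendInputs {q m w : ℕ} (f : Fin m ↪ Fin w) (y : Bits q) (u : Bits m) :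
    Function.extend (extendInputs q f) (Fin.append y u) (fun _ => false) =
      Fin.append y (Function.extend f u fun _ => false) := by
  funext j
  have hinj := (extendInputs q f).injective
  induction j using Fin.addCases with
  | left j =>
    rw [Fin.append_left, ← extendInputs_castAdd q f, hinj.extend_apply, Fin.append_left]
  | right j =>
    rw [Fin.append_right]
    by_cases hj : ∃ i, f i = j
    · obtain ⟨i, rfl⟩ := hj
      rw [← extendInputs_natAdd, hinj.extend_apply, Fin.append_right, f.injective.extend_apply]
    · rw [Function.extend_apply' _ _ _ hj, Function.extend_apply']
      rintro ⟨i, hi⟩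
      induction i using Fin.addCases with
      | left i => exact castAdd_ne_natAdd i j (by rwa [extendInputs_castAdd] at hi)
      | right i =>
        rw [extendInputs_natAdd] at hi
        exact hj ⟨i, (Fin.natAddEmb q).injective hi⟩

/-- Conjugation of `|y⟩⟨y| ⊗ ρ` by a matrix that is block diagonal with respect to the first
qubits. -/
theorem conj_tensor_classicalState {q m w : ℕ} (e : Fin q ↪ Fin m)
    (V : Matrix (Bits (q + w)) (Bits (q + m)) ℂ) (W : Matrix (Bits w) (Bits m) ℂ)
    (hV : ∀ y' x y u, V (Fin.append y' x) (Fin.append y u) =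
      if y' = y then W x (flipBits e y u) else 0)
    (y : Bits q) (ρ : Op m) (y' : Bits q) (x x' : Bits w) :
    (V * tensor (classicalState (PMF.pure y)) ρ * Vᴴ) (Fin.append y' x) (Fin.append y' x') =
      if y' = y then (W * ρ.submatrix (flipBits e y) (flipBits e y) * Wᴴ) x x' else 0 := by
  have hρ : ∀ (y₁ y₂ : Bits q) (u₁ u₂ : Bits m),
      tensor (classicalState (PMF.pure y)) ρ (Fin.append y₁ u₁) (Fin.append y₂ u₂) =
      if y₁ = y ∧ y₂ = y then ρ u₁ u₂ else 0 := by
    intro y₁ y₂ u₁ u₂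
    simp only [tensor, Matrix.of_apply, Fin.append_left, Fin.append_right, classicalState,
      Matrix.diagonal_apply, PMF.pure_apply]
    by_cases h₁ : y₁ = y₂
    · subst h₁
      by_cases h₂ : y₁ = y <;> simp [h₂]
    · rw [if_neg h₁, if_neg fun h => h₁ (h.1.trans h.2.symm), zero_mul]
  have hσ : ∀ U : Bits (q + m), (V *
      tensor (classicalState (PMF.pure y)) ρ) (Fin.append y' x) U =
      if y' = y ∧ (fun i => U (Fin.castAdd m i)) = y then
        ∑ u, W x (flipBits e y u) * ρ u fun i => U (Fin.natAdd q i)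
      else 0 := by
    intro U
    conv_lhs => rw [← Fin.append_castAdd_natAdd (f := U)]
    rw [Matrix.mul_apply, sum_append]
    simp only [hV, hρ]
    rw [Finset.sum_eq_single y]
    · by_cases h : y' = y <;> by_cases h' : (fun i => U (Fin.castAdd m i)) = y <;> simp [h, h']
    · intro z _ hz
      simp [hz]
    · simp
  rw [Matrix.mul_apply]
  refine (sum_append _).trans ?_
  simp only [hσ, Fin.append_left, Fin.append_right, Matrix.conjTranspose_apply, hV]
  rw [Finset.sum_eq_single y]
  · by_cases h : y' = y
    · simp only [h, and_self, if_true]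
      rw [Matrix.mul_apply]
      simp only [Matrix.mul_apply (M := W), Matrix.submatrix_apply,
        Matrix.conjTranspose_apply]
      -- Reindexing both column sums by the flip moves it from the columns of `W` onto the entries
      -- of `ρ`.
      rw [← Equiv.sum_comp (flipBits_involutive e y).toPerm]
      refine Finset.sum_congr rfl fun u _ => ?_
      rw [← Equiv.sum_comp (flipBits_involutive e y).toPerm]
      simp only [Function.Involutive.coe_toPerm, flipBits_flipBits]
    · simp [h]
  · intro z _ hz
    simp [hz]
  · simp

/-- The partial trace over the wires outside the range of `out`. -/
def traceOutWires {n w : ℕ} (out : Fin n ↪ Fin w) (σ : Op w) : Op n := Matrix.of fun u v =>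
  ∑ x : Bits w, ∑ y : Bits w,
    if (∀ i, x (out i) = u i) ∧ (∀ i, y (out i) = v i) ∧
        (∀ j, j ∉ Set.range out → x j = y j) then σ x y else 0

namespace Circuit

variable {q m n : ℕ}

/-- The circuit that adds its first `q` input bits to the inputs `e i` of `C` and then runs `C`. -/
def xorInput (C : Circuit m n) (e : Fin q ↪ Fin m) : Circuit (q + m) n where
  wires := q + C.wires
  inp := extendInputs q C.inp
  out := C.out.trans (Fin.natAddEmb q)
  gates := ((List.finRange q).map fun i => Gate.CNOT (Fin.castAdd C.wires i)
    (Fin.natAdd q (C.inp (e i))) (castAdd_ne_natAdd _ _)) ++ C.gates.map (Gate.shift q)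

theorem size_xorInput (C : Circuit m n) (e : Fin q ↪ Fin m) :
    (C.xorInput e).size = C.size + 3 * q := by
  simp only [size, xorInput, List.length_append, List.length_map, List.length_finRange]
  ring

/-- On basis labels, the CNOT layer after initialization has the same effect as initializing `C`
with flipped input bits while keeping `y` on the front wires. -/
theorem cnotFold_xorInput (C : Circuit m n) (e : Fin q ↪ Fin m) (y : Bits q) (u : Bits m) :
    cnotFold (Fin.castAdd C.wires) (fun i => Fin.natAdd q (C.inp (e i))) (List.finRange q)
      (Fin.append y (Function.extend C.inp u fun _ => false)) =
      Fin.append y (Function.extend C.inp (flipBits e y u) fun _ => false) := by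
  funext j
  induction j using Fin.addCases with
  | left j =>
    rw [cnotFold_of_notMem _ _ _ _ _ fun i _ => (castAdd_ne_natAdd j _).symm, Fin.append_left,
      Fin.append_left]
  | right j =>
    rw [Fin.append_right]
    by_cases hj : ∃ i, C.inp (e i) = j
    · obtain ⟨i, rfl⟩ := hj
      rw [C.inp.injective.extend_apply, flipBits_apply]
      refine (cnotFold_of_mem (Fin.castAdd C.wires) (fun i => Fin.natAdd q (C.inp (e i)))
        (fun i i' h => e.injective (C.inp.injective ((Fin.natAddEmb q).injective h)))
        (fun i i' => castAdd_ne_natAdd _ _) _ (List.nodup_finRange q) _ i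
        (List.mem_finRange i)).trans ?_
      rw [Fin.append_left, Fin.append_right, C.inp.injective.extend_apply]
    · rw [cnotFold_of_notMem (Fin.castAdd C.wires) (fun i => Fin.natAdd q (C.inp (e i))) _ _
        (Fin.natAdd q j) fun i _ h => hj ⟨i, (Fin.natAddEmb q).injective h⟩, Fin.append_right]
      by_cases hj' : ∃ p, C.inp p = j
      · obtain ⟨p, rfl⟩ := hj'
        rw [C.inp.injective.extend_apply, C.inp.injective.extend_apply, flipBits_of_notMem]
        exact fun i h => hj ⟨i, by rw [h]⟩
      · rw [Function.extend_apply' _ _ _ hj', Function.extend_apply' _ _ _ hj']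

theorem xorInput_isometry (C : Circuit m n) (e : Fin q ↪ Fin m) (y' : Bits q) (x : Bits C.wires)
    (y : Bits q) (u : Bits m) :
    ((C.xorInput e).unitary * (C.xorInput e).initIso) (Fin.append y' x) (Fin.append y u) =
      if y' = y then (C.unitary * C.initIso) x (flipBits e y u) else 0 := by
  have h₁ : (C.xorInput e).unitary * (C.xorInput e).initIso =
      (C.gates.map (Gate.shift q)).foldl (fun U g => g.mat * U)
        (funMat fun U => cnotFold (Fin.castAdd C.wires) (fun i => Fin.natAdd q (C.inp (e i)))
          (List.finRange q) (Function.extend (extendInputs q C.inp) U fun _ => false)) := by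
    rw [unitary, foldl_gates_mul, Matrix.one_mul,
      ← foldl_cnot_funMat _ _ fun i => castAdd_ne_natAdd _ _, ← List.foldl_append]
    rfl
  have h₂ : C.unitary * C.initIso = C.gates.foldl (fun U g => g.mat * U) C.initIso := by
    rw [unitary, foldl_gates_mul, Matrix.one_mul]
  rw [h₁, h₂]
  refine foldl_shift C.gates _ C.initIso (flipBits e) (fun y' x y u => ?_) y' x y u
  simp only [funMat, Matrix.of_apply, extend_extendInputs, cnotFold_xorInput, append_inj, initIso,
    ite_and]

/-- All front wires are discarded, so only blocks of `σ` diagonal in them enter the trace, and by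
hypothesis a single one is nonzero. -/
theorem traceOutWires_natAdd (C : Circuit m n) (σ : Op (q + C.wires))
    (y : Bits q) (τ : Op C.wires)
    (h : ∀ y' x x', σ (Fin.append y' x) (Fin.append y' x') = if y' = y then τ x x' else 0) :
    traceOutWires (C.out.trans (Fin.natAddEmb q)) σ = C.traceOut τ := by
  ext u v
  have hcond : ∀ (y₁ y₂ : Bits q) (x₁ x₂ : Bits C.wires),
      ((∀ i, Fin.append y₁ x₁ ((C.out.trans (Fin.natAddEmb q)) i) = u i) ∧
        (∀ i, Fin.append y₂ x₂ ((C.out.trans (Fin.natAddEmb q)) i) = v i) ∧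
        (∀ j, j ∉ Set.range (C.out.trans (Fin.natAddEmb q)) → Fin.append y₁ x₁ j = Fin.append y₂ x₂ j)) ↔
      y₁ = y₂ ∧ (∀ i, x₁ (C.out i) = u i) ∧ (∀ i, x₂ (C.out i) = v i) ∧
        (∀ j, j ∉ Set.range C.out → x₁ j = x₂ j) := by
    intro y₁ y₂ x₁ x₂
    have hout : ∀ i, (C.out.trans (Fin.natAddEmb q)) i = Fin.natAdd q (C.out i) := fun i => rfl
    have hr : (∀ j, j ∉ Set.range (C.out.trans (Fin.natAddEmb q)) →
        Fin.append y₁ x₁ j = Fin.append y₂ x₂ j) ↔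
        y₁ = y₂ ∧ (∀ j, j ∉ Set.range C.out → x₁ j = x₂ j) := by
      constructor
      · refine fun h => ⟨funext fun j => ?_, fun j hj => ?_⟩
        · have := h (Fin.castAdd C.wires j) fun ⟨i, hi⟩ => castAdd_ne_natAdd j (C.out i) hi.symm
          rwa [Fin.append_left, Fin.append_left] at this
        · have := h (Fin.natAdd q j) fun ⟨i, hi⟩ => hj ⟨i, (Fin.natAddEmb q).injective hi⟩
          rwa [Fin.append_right, Fin.append_right] at this
      · rintro ⟨rfl, h⟩ j hj
        induction j using Fin.addCases with
        | left j => rw [Fin.append_left, Fin.append_left]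
        | right j =>
          rw [Fin.append_right, Fin.append_right]
          exact h j fun ⟨i, hi⟩ => hj ⟨i, by rw [hout, hi]⟩
    rw [hr]
    simp only [hout, Fin.append_right]
    tauto
  simp only [traceOut, traceOutWires, Matrix.of_apply]
  refine (sum_append _).trans ?_
  rw [Finset.sum_eq_single y]
  · refine Finset.sum_congr rfl fun x₁ _ => ?_
    refine (sum_append _).trans ?_
    rw [Finset.sum_eq_single y]
    · refine Finset.sum_congr rfl fun x₂ _ => ?_
      simp only [hcond, true_and, h, if_true]
    · intro z _ hz
      refine Finset.sum_eq_zero fun x₂ _ => ?_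
      exact if_neg fun h' => hz ((hcond _ _ _ _).mp h').1.symm
    · simp
  · intro z _ hz
    refine Finset.sum_eq_zero fun x₁ _ => ?_
    refine (sum_append _).trans (Finset.sum_eq_zero fun z' _ => Finset.sum_eq_zero fun x₂ _ => ?_)
    split_ifs with hc
    · obtain ⟨rfl, -⟩ := (hcond _ _ _ _).mp hc
      rw [h, if_neg hz]
    · rfl
  · simp

theorem run_xorInput (C : Circuit m n) (e : Fin q ↪ Fin m) (y : Bits q) (ρ : Op m) :
    (C.xorInput e).run (tensor (classicalState (PMF.pure y)) ρ) =
      C.run (ρ.submatrix (flipBits e y) (flipBits e y)) :=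
  C.traceOutWires_natAdd _ y _ fun y' x x' =>
    conj_tensor_classicalState e _ (C.unitary * C.initIso) (C.xorInput_isometry e) y ρ y' x x'

end Circuit

/-! ### States -/

theorem tensor_append {m n : ℕ} (ρ : Op m) (σ : Op n) (x x' : Bits m) (y y' : Bits n) :
    tensor ρ σ (Fin.append x y) (Fin.append x' y') = ρ x x' * σ y y' := by
  simp [tensor]

theorem tensor_sum_left {ι : Type*} (s : Finset ι) {m n : ℕ} (ρ : ι → Op m) (σ : Op n) :
    tensor (∑ i ∈ s, ρ i) σ = ∑ i ∈ s, tensor (ρ i) σ := by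
  ext x y
  simp [tensor, Matrix.sum_apply, Finset.sum_mul]

theorem tensor_smul_left {m n : ℕ} (a : ℝ) (ρ : Op m) (σ : Op n) :
    tensor (a • ρ) σ = a • tensor ρ σ := by
  ext x y
  simp [tensor, mul_assoc]

theorem tensor_smul_right {m n : ℕ} (a : ℝ) (ρ : Op m) (σ : Op n) :
    tensor ρ (a • σ) = a • tensor ρ σ := by
  ext x y
  simp [tensor, mul_left_comm]

theorem tensor_add_left {m n : ℕ} (ρ ρ' : Op m) (σ : Op n) :
    tensor (ρ + ρ') σ = tensor ρ σ + tensor ρ' σ := by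
  ext x y
  simp [tensor, add_mul]

theorem IsDensity.tensor {m n : ℕ} {ρ : Op m} {σ : Op n} (hρ : IsDensity ρ) (hσ : IsDensity σ) :
    IsDensity (tensor ρ σ) := by
  refine ⟨(hρ.1.kronecker hσ.1).submatrix fun x : Bits (m + n) =>
    ((fun i => x (Fin.castAdd n i) : Bits m), (fun j => x (Fin.natAdd m j) : Bits n)), ?_⟩
  simp only [Matrix.trace, Matrix.diag_apply]
  rw [sum_append]
  simp only [tensor_append, ← Finset.mul_sum, ← Finset.sum_mul]
  have h₁ : ∑ x, ρ x x = 1 := hρ.2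
  have h₂ : ∑ x, σ x x = 1 := hσ.2
  rw [h₁, h₂, one_mul]

/-! ### Density matrices under preparation, channels and measurement -/

theorem isDensity_classicalState {n : ℕ} (μ : PMF (Bits n)) : IsDensity (classicalState μ) := by
  refine ⟨Matrix.PosSemidef.diagonal fun y => ?_, ?_⟩
  · simp only [Pi.zero_apply]
    exact_mod_cast ENNReal.toReal_nonneg
  · rw [classicalState, Matrix.trace_diagonal, ← Complex.ofReal_sum,
      ← ENNReal.toReal_sum fun x _ => μ.apply_ne_top x,
      ← tsum_fintype (L := .unconditional _), μ.tsum_coe]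
    simp

theorem classicalState_eq_sum {n : ℕ} (μ : PMF (Bits n)) :
    classicalState μ = ∑ x, (μ x).toReal • classicalState (PMF.pure x) := by
  ext u v
  simp only [Matrix.sum_apply, Matrix.smul_apply, classicalState, Matrix.diagonal_apply,
    PMF.pure_apply]
  by_cases h : u = v <;> simp [h, apply_ite ENNReal.toReal, apply_ite Complex.ofReal]

theorem classicalState_pure_flipBits {q m : ℕ} (e : Fin q ↪ Fin m) (y : Bits q) (z u v : Bits m) :
    classicalState (PMF.pure z) (flipBits e y u) (flipBits e y v) =
      classicalState (PMF.pure (flipBits e y z)) u v := by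
  simp only [classicalState, Matrix.diagonal_apply, PMF.pure_apply,
    (flipBits_involutive e y).injective.eq_iff, (flipBits_involutive e y).eq_iff]
  congr

theorem traceOutWires_posSemidef {n w : ℕ} (out : Fin n ↪ Fin w) {σ : Op w} (hσ : σ.PosSemidef) :
    (traceOutWires out σ).PosSemidef := by
  classical
  -- The partial trace is a sum of submatrices, one for each basis label of the discarded wires.
  -- Such a label is represented by the string that vanishes on the output wires.
  have h : traceOutWires out σ = ∑ z : Bits w with ∀ i, z (out i) = false,
      σ.submatrix (fun u => Function.extend out u z) (fun u => Function.extend out u z) := by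
    ext u v
    have hext : ∀ (u : Bits n) (x z : Bits w), (∀ i, z (out i) = false) →
        (Function.extend out u z = x ↔
          (∀ i, x (out i) = u i) ∧ ∀ j, j ∉ Set.range out → x j = z j) := by
      intro u x z _
      constructor
      · rintro rfl
        exact ⟨fun i => out.injective.extend_apply _ _ _, fun j hj =>
          Function.extend_apply' _ _ _ hj⟩
      · rintro ⟨h₁, h₂⟩
        funext j
        by_cases hj : j ∈ Set.range out
        · obtain ⟨i, rfl⟩ := hj
          rw [out.injective.extend_apply, h₁]
        · rw [Function.extend_apply' _ _ _ hj, h₂ j hj]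
    simp only [traceOutWires, Matrix.of_apply, Matrix.sum_apply, Matrix.submatrix_apply]
    rw [← Finset.sum_product', ← Finset.sum_filter]
    symm
    refine Finset.sum_bij (fun z _ => (Function.extend out u z, Function.extend out v z))
      ?_ ?_ ?_ ?_
    · intro z hz
      rw [Finset.mem_filter] at hz
      have h₁ := (hext u _ z hz.2).mp rfl
      have h₂ := (hext v _ z hz.2).mp rfl
      simp only [Finset.mem_filter, Finset.mem_product, Finset.mem_univ, true_and]
      exact ⟨h₁.1, h₂.1, fun j hj => (h₁.2 j hj).trans (h₂.2 j hj).symm⟩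
    · intro z hz z' hz' h
      rw [Finset.mem_filter] at hz hz'
      have h' := (Prod.ext_iff.mp h).1
      funext j
      by_cases hj : j ∈ Set.range out
      · obtain ⟨i, rfl⟩ := hj
        rw [hz.2, hz'.2]
      · have := congrFun h' j
        simpa only [Function.extend_apply' _ _ _ hj] using this
    · rintro ⟨x, y⟩ hxy
      simp only [Finset.mem_filter, Finset.mem_product, Finset.mem_univ, true_and] at hxy
      have hz : ∀ i, Function.extend out (fun _ => false) x (out i) = false := fun i =>
        out.injective.extend_apply _ _ _
      have hz' : ∀ j, j ∉ Set.range out → Function.extend out (fun _ => false) x j = x j :=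
        fun j hj => Function.extend_apply' _ _ _ hj
      refine ⟨Function.extend out (fun _ => false) x, by simpa using hz, Prod.ext ?_ ?_⟩
      · exact (hext u _ _ hz).mpr ⟨hxy.1, fun j hj => (hz' j hj).symm⟩
      · exact (hext v _ _ hz).mpr ⟨hxy.2.1, fun j hj =>
          (hxy.2.2 j hj).symm.trans (hz' j hj).symm⟩
    · intro z _
      rfl
  rw [h]
  exact Matrix.posSemidef_sum _ fun z _ => hσ.submatrix _

theorem Circuit.run_isDensity {m n : ℕ} (C : Circuit m n) {ρ : Op m} (hρ : IsDensity ρ) :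
    IsDensity (C.run ρ) :=
  ⟨traceOutWires_posSemidef C.out (hρ.1.mul_mul_conjTranspose_same _),
    (C.run_diag_sum ρ).trans hρ.2⟩

theorem isDensity_one : IsDensity (1 : Op 0) :=
  ⟨Matrix.PosSemidef.one, by simp [Matrix.trace_one]⟩

theorem NonuniformQPT.run_isDensity {m k : ℕ → ℕ} (A : NonuniformQPT m k) (n : ℕ) {ρ : Op (m n)}
    (hρ : IsDensity ρ) : IsDensity (A.run n ρ) :=
  (A.circuit n).run_isDensity (hρ.tensor (A.advice_density n))

/-- A positive semidefinite matrix is a nonnegative multiple of a density matrix. -/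
theorem exists_isDensity_smul {n : ℕ} {ρ : Op n} (hρ : ρ.PosSemidef) :
    ∃ ρ' : Op n, IsDensity ρ' ∧ ρ = ρ.trace.re • ρ' := by
  have htr : ρ.trace = (ρ.trace.re : ℂ) := by
    have := (Complex.le_def.mp hρ.trace_nonneg).2
    exact Complex.ext (by simp) (by simpa using this.symm)
  by_cases h : ρ.trace.re = 0
  -- Trace zero forces `ρ = 0`, so any density matrix serves.
  · refine ⟨classicalState (PMF.pure fun _ => false), isDensity_classicalState _, ?_⟩
    rw [h, zero_smul]
    exact hρ.trace_eq_zero_iff.mp (by rw [htr, h, Complex.ofReal_zero])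
  · have hpos : 0 ≤ (ρ.trace.re)⁻¹ := inv_nonneg.mpr (Complex.le_def.mp hρ.trace_nonneg).1
    refine ⟨(ρ.trace.re)⁻¹ • ρ, ⟨hρ.smul hpos, ?_⟩, ?_⟩
    · rw [Matrix.trace_smul]
      conv_lhs => rw [htr]
      rw [Complex.ofReal_re, Complex.real_smul, ← Complex.ofReal_mul, inv_mul_cancel₀ h,
        Complex.ofReal_one]
    · rw [smul_smul, mul_inv_cancel₀ h, one_smul]

theorem sum_trace_outcomePart {q s : ℕ} {σ : Op (q + s)} (hσ : IsDensity σ) :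
    ∑ r, (CommitmentScheme.outcomePart σ r).trace.re = 1 := by
  have h : ∑ x, σ x x = 1 := hσ.2
  rw [sum_append] at h
  rw [← Complex.re_sum]
  exact (congr_arg Complex.re h).trans Complex.one_re

theorem outcomePart_posSemidef {q s : ℕ} {σ : Op (q + s)} (hσ : σ.PosSemidef) (r : Bits q) :
    (CommitmentScheme.outcomePart σ r).PosSemidef :=
  hσ.submatrix fun u : Bits s => Fin.append r u

/-! ### Linearity of acceptance probabilities -/

theorem traceOutWires_add {n w : ℕ} (out : Fin n ↪ Fin w) (σ τ : Op w) :
    traceOutWires out (σ + τ) = traceOutWires out σ + traceOutWires out τ := by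
  ext u v
  simp only [traceOutWires, Matrix.of_apply, Matrix.add_apply, ← Finset.sum_add_distrib]
  refine Finset.sum_congr rfl fun x _ => Finset.sum_congr rfl fun y _ => ?_
  split_ifs <;> simp

theorem traceOutWires_smul {n w : ℕ} (out : Fin n ↪ Fin w) (a : ℝ) (σ : Op w) :
    traceOutWires out (a • σ) = a • traceOutWires out σ := by
  ext u v
  simp only [traceOutWires, Matrix.of_apply, Matrix.smul_apply, Finset.smul_sum, smul_ite,
    smul_zero]

/-- The acceptance probability as a linear functional of the input state. -/
def NonuniformQPT.acceptLinear {m : ℕ → ℕ} (A : NonuniformQPT m fun _ => 1) (n : ℕ) :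
    Op (m n) →ₗ[ℝ] ℝ where
  toFun := A.accept n
  map_add' ρ σ := by
    have h : A.run n (ρ + σ) = A.run n ρ + A.run n σ := by
      simp only [NonuniformQPT.run, Circuit.run, tensor_add_left, Matrix.mul_add, Matrix.add_mul]
      exact traceOutWires_add _ _ _
    simp [NonuniformQPT.accept, h]
  map_smul' a ρ := by
    have h : A.run n (a • ρ) = a • A.run n ρ := by
      simp only [NonuniformQPT.run, Circuit.run, tensor_smul_left, Matrix.mul_smul,
        Matrix.smul_mul]
      exact traceOutWires_smul _ _ _
    simp [NonuniformQPT.accept, h]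

theorem NonuniformQPT.accept_sum {m : ℕ → ℕ} (A : NonuniformQPT m fun _ => 1) (n : ℕ)
    {ι : Type*} (s : Finset ι) (ρ : ι → Op (m n)) :
    A.accept n (∑ i ∈ s, ρ i) = ∑ i ∈ s, A.accept n (ρ i) :=
  map_sum (A.acceptLinear n) ρ s

theorem NonuniformQPT.accept_smul {m : ℕ → ℕ} (A : NonuniformQPT m fun _ => 1) (n : ℕ)
    (a : ℝ) (ρ : Op (m n)) : A.accept n (a • ρ) = a * A.accept n ρ :=
  map_smul (A.acceptLinear n) a ρ

theorem NonuniformQPT.accept_classicalState {m : ℕ → ℕ} (A : NonuniformQPT m fun _ => 1) (n : ℕ)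
    (μ : PMF (Bits (m n))) :
    A.accept n (classicalState μ) =
      ∑ x, (μ x).toReal * A.accept n (classicalState (PMF.pure x)) := by
  rw [classicalState_eq_sum, A.accept_sum]
  simp only [A.accept_smul]

theorem NonuniformQPT.accept_tensor_classicalState {c s : ℕ → ℕ}
    (D : NonuniformQPT (fun n => c n + s n) fun _ => 1) (n : ℕ) (μ : PMF (Bits (c n)))
    (ρ : Op (s n)) :
    D.accept n (tensor (classicalState μ) ρ) =
      ∑ x, (μ x).toReal * D.accept n (tensor (classicalState (PMF.pure x)) ρ) := by
  rw [classicalState_eq_sum, tensor_sum_left, D.accept_sum]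
  simp only [tensor_smul_left, D.accept_smul]

/-! ### The adversary against the generator -/

/-- The algorithm that adds its input to the bits `e n i` of `z n` and runs `D` on the result and
on the state `ρ n`. -/
def xorAdversary {c s q : ℕ → ℕ} (D : NonuniformQPT (fun n => c n + s n) fun _ => 1)
    (hq : ∃ p : Polynomial ℕ, ∀ n, q n ≤ p.eval n) (e : ∀ n, Fin (q n) ↪ Fin (c n))
    (z : ∀ n, Bits (c n)) (ρ : ∀ n, Op (s n)) (hρ : ∀ n, IsDensity (ρ n)) :
    NonuniformQPT q fun _ => 1 where
  adviceLen n := c n + s n + D.adviceLen n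
  circuit n := (D.circuit n).xorInput
    ((e n).trans ((Fin.castAddEmb (s n)).trans (Fin.castAddEmb (D.adviceLen n))))
  advice n := tensor (tensor (classicalState (PMF.pure (z n))) (ρ n)) (D.advice n)
  advice_density n := ((isDensity_classicalState _).tensor (hρ n)).tensor (D.advice_density n)
  poly := by
    obtain ⟨p, hp⟩ := D.poly
    obtain ⟨p', hp'⟩ := hq
    refine ⟨p + 3 * p', fun n => ?_⟩
    have h₁ := hp n
    have h₂ := hp' n
    have heval : (p + 3 * p').eval n = p.eval n + 3 * p'.eval n := by simp
    rw [Circuit.size_xorInput, heval]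
    omega

theorem flipBits_castAdd {q c s : ℕ} (e : Fin q ↪ Fin c) (y : Bits q) (u : Bits (c + s)) :
    (fun i => flipBits (e.trans (Fin.castAddEmb s)) y u (Fin.castAdd s i)) =
      flipBits e y fun i => u (Fin.castAdd s i) := by
  funext i
  by_cases hi : ∃ j, e j = i
  · obtain ⟨j, rfl⟩ := hi
    rw [flipBits_apply]
    exact flipBits_apply (e.trans (Fin.castAddEmb s)) y u j
  · push Not at hi
    rw [flipBits_of_notMem _ _ _ hi, flipBits_of_notMem]
    exact fun j h => hi j ((Fin.castAddEmb s).injective h)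

theorem flipBits_natAdd {q c s : ℕ} (e : Fin q ↪ Fin c) (y : Bits q) (u : Bits (c + s)) :
    (fun i => flipBits (e.trans (Fin.castAddEmb s)) y u (Fin.natAdd c i)) =
      fun i => u (Fin.natAdd c i) := by
  funext i
  exact flipBits_of_notMem _ _ _ fun j => castAdd_ne_natAdd (e j) i

theorem submatrix_flipBits_tensor {q c s : ℕ} (e : Fin q ↪ Fin c) (y : Bits q) (ρ : Op c)
    (σ : Op s) :
    (tensor ρ σ).submatrix (flipBits (e.trans (Fin.castAddEmb s)) y)
      (flipBits (e.trans (Fin.castAddEmb s)) y) =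
      tensor (ρ.submatrix (flipBits e y) (flipBits e y)) σ := by
  ext u v
  simp only [tensor, Matrix.submatrix_apply, Matrix.of_apply, flipBits_castAdd, flipBits_natAdd]

theorem xorAdversary_accept {c s q : ℕ → ℕ} (D : NonuniformQPT (fun n => c n + s n) fun _ => 1)
    (hq : ∃ p : Polynomial ℕ, ∀ n, q n ≤ p.eval n) (e : ∀ n, Fin (q n) ↪ Fin (c n))
    (z : ∀ n, Bits (c n)) (ρ : ∀ n, Op (s n)) (hρ : ∀ n, IsDensity (ρ n)) (n : ℕ)
    (μ : PMF (Bits (q n))) :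
    (xorAdversary D hq e z ρ hρ).accept n (classicalState μ) =
      ∑ y, (μ y).toReal *
        D.accept n (tensor (classicalState (PMF.pure (flipBits (e n) y (z n)))) (ρ n)) := by
  rw [NonuniformQPT.accept_classicalState]
  refine Finset.sum_congr rfl fun y _ => ?_
  congr 1
  have h : (xorAdversary D hq e z ρ hρ).run n (classicalState (PMF.pure y)) =
      D.run n (tensor (classicalState (PMF.pure (flipBits (e n) y (z n)))) (ρ n)) := by
    refine ((D.circuit n).run_xorInput _ y _).trans ?_
    -- Regrouping the embedding lets the flip pass first the distinguisher's advice and then the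
    -- receiver's leftover state.
    rw [← Function.Embedding.trans_assoc]
    change (D.circuit n).run (submatrix (tensor _ _) _ _) = _
    rw [submatrix_flipBits_tensor, submatrix_flipBits_tensor]
    have hz : (classicalState (PMF.pure (z n))).submatrix (flipBits (e n) y) (flipBits (e n) y) =
        classicalState (PMF.pure (flipBits (e n) y (z n))) := by
      ext u v
      exact classicalState_pure_flipBits (e n) y (z n) u v
    rw [hz]
    rfl
  exact congr_arg (fun ρ : Op 1 => (ρ (fun _ => true) (fun _ => true)).re) h

/-! ### The hybrid argument -/

theorem abs_weighted_sum_le {ι : Type} [Fintype ι] {r g : ι → ℝ} {B : ℝ} (hr : ∀ i, 0 ≤ r i)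
    (hr1 : ∑ i, r i = 1) (hg : ∀ i, |g i| ≤ B) : |∑ i, r i * g i| ≤ B :=
  calc |∑ i, r i * g i| ≤ ∑ i, |r i * g i| := Finset.abs_sum_le_sum_abs _ _
    _ ≤ ∑ i, r i * B := Finset.sum_le_sum fun i _ => by
      rw [abs_mul, abs_of_nonneg (hr i)]
      exact mul_le_mul_of_nonneg_left (hg i) (hr i)
    _ = B := by rw [← Finset.sum_mul, hr1, one_mul]

/-- Two product distributions whose factors cannot be told apart with advantage more than `δ` when
the other coordinates are fixed. -/
theorem hybrid_le {α : Type} [Fintype α] {p p' : α → ℝ} (hp : ∀ a, 0 ≤ p a) (hp1 : ∑ a, p a = 1)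
    (hp' : ∀ a, 0 ≤ p' a) (hp'1 : ∑ a, p' a = 1) (δ : ℝ) : (n : ℕ) → (f : (Fin n → α) → ℝ) →
    (∀ j w, |∑ a, p a * f (Function.update w j a) - ∑ a, p' a * f (Function.update w j a)| ≤ δ) →
    |∑ v : Fin n → α, (∏ i, p (v i)) * f v - ∑ v : Fin n → α, (∏ i, p' (v i)) * f v| ≤ n * δ
  | 0, f, _ => by simp
  | n + 1, f, hf => by
    have hsplit : ∀ r : α → ℝ, ∑ v : Fin (n + 1) → α, (∏ i, r (v i)) * f v =
        ∑ a, r a * ∑ v : Fin n → α, (∏ i, r (v i)) * f (Fin.cons a v) := by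
      intro r
      rw [← (Fin.consEquiv fun _ => α).sum_comp, Fintype.sum_prod_type]
      refine Finset.sum_congr rfl fun a _ => ?_
      rw [Finset.mul_sum]
      refine Finset.sum_congr rfl fun v _ => ?_
      simp only [Fin.consEquiv, Equiv.coe_fn_mk, Fin.prod_univ_succ, Fin.cons_zero, Fin.cons_succ,
        mul_assoc]
    have htail : ∀ a, |∑ v : Fin n → α, (∏ i, p (v i)) * f (Fin.cons a v) -
        ∑ v : Fin n → α, (∏ i, p' (v i)) * f (Fin.cons a v)| ≤ n * δ := fun a =>
      hybrid_le hp hp1 hp' hp'1 δ n (fun v => f (Fin.cons a v)) fun j w => by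
        simpa only [Fin.cons_update] using hf j.succ (Fin.cons a w)
    have hhead : ∀ v : Fin n → α, |∑ a, p a * f (Fin.cons a v) - ∑ a, p' a * f (Fin.cons a v)| ≤ δ := by
      intro v
      by_cases hα : Nonempty α
      · obtain ⟨a₀⟩ := hα
        simpa only [Fin.update_cons_zero] using hf 0 (Fin.cons a₀ v)
      · rw [not_nonempty_iff] at hα
        simp at hp1
    have hmass : ∑ v : Fin n → α, ∏ i, p' (v i) = 1 := by
      have := Finset.prod_univ_sum (fun _ : Fin n => (Finset.univ : Finset α)) fun _ a => p' a
      rw [Fintype.piFinset_univ] at this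
      rw [← this, hp'1, Finset.prod_const_one]
    rw [hsplit, hsplit]
    -- Insert the mixed product with head from `p` and tail from `p'`: the tail costs `n * δ` by
    -- induction and the head one more `δ`.
    have hdecomp : (∑ a, p a * ∑ v : Fin n → α, (∏ i, p (v i)) * f (Fin.cons a v)) -
        ∑ a, p' a * ∑ v : Fin n → α, (∏ i, p' (v i)) * f (Fin.cons a v) =
        (∑ a, p a * (∑ v : Fin n → α, (∏ i, p (v i)) * f (Fin.cons a v) -
          ∑ v : Fin n → α, (∏ i, p' (v i)) * f (Fin.cons a v))) +
        ∑ v : Fin n → α, (∏ i, p' (v i)) *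
          (∑ a, p a * f (Fin.cons a v) - ∑ a, p' a * f (Fin.cons a v)) := by
      simp only [mul_sub, Finset.sum_sub_distrib, Finset.mul_sum]
      have hc : ∀ r : α → ℝ, ∑ v : Fin n → α, ∑ a, (∏ i, p' (v i)) * (r a * f (Fin.cons a v)) =
          ∑ a, ∑ v : Fin n → α, r a * ((∏ i, p' (v i)) * f (Fin.cons a v)) := by
        intro r
        rw [Finset.sum_comm]
        simp only [mul_left_comm]
      rw [hc, hc]
      ring
    rw [hdecomp]
    refine (abs_add_le _ _).trans ?_
    have h₁ := abs_weighted_sum_le hp hp1 htail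
    have h₂ := abs_weighted_sum_le (r := fun v : Fin n → α => ∏ i, p' (v i))
      (fun v => Finset.prod_nonneg fun i _ => hp' _) hmass hhead
    push_cast
    linarith

/-! ### Hiding -/

theorem sum_toReal_eq_one {α : Type*} [Fintype α] (μ : PMF α) : ∑ a, (μ a).toReal = 1 := by
  rw [← ENNReal.toReal_sum fun x _ => μ.apply_ne_top x, ← tsum_fintype (L := .unconditional _),
    μ.tsum_coe, ENNReal.toReal_one]

theorem sum_map_toReal {α β : Type*} [Fintype α] [Fintype β] (μ : PMF α) (g : α → β) (f : β → ℝ) :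
    ∑ b, ((μ.map g) b).toReal * f b = ∑ a, (μ a).toReal * f (g a) := by
  classical
  have h : ∀ b, ((μ.map g) b).toReal = ∑ a, if b = g a then (μ a).toReal else 0 := by
    intro b
    rw [PMF.map_apply, tsum_fintype, ENNReal.toReal_sum]
    · refine Finset.sum_congr rfl fun a _ => ?_
      split_ifs <;> simp
    · intro a _
      split_ifs
      · exact μ.apply_ne_top a
      · simp
  simp only [h, Finset.sum_mul]
  rw [Finset.sum_comm]
  simp

/-- Averaging over independent seeds commutes with the product, so with the seeds hidden the outputs
are independent and identically distributed. -/
theorem piPMF_bind {α β : Type} (m : ℕ) (μ : PMF α) (κ : α → PMF β) :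
    ((piPMF m fun _ => μ).bind fun k => piPMF m fun i => κ (k i)) =
      piPMF m fun _ => μ.bind κ := by
  ext v
  rw [piPMF_apply]
  change Ex (piPMF m fun _ => μ) (fun k => piPMF m (fun i => κ (k i)) v) = _
  simp only [piPMF_apply]
  exact Ex_piPMF_prod m (fun _ => μ) fun i k => κ k (v i)

/-- The law of the output of a circuit on a uniform input. -/
def seedDist {m n : ℕ} (C : Circuit m n) : PMF (Bits n) :=
  (PMF.uniformOfFintype (Bits m)).bind C.outDist

theorem commit_fst_dist (n : ℕ) (b : Bool) (r : Bits (3 * n)) :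
    ((naorCommitment G).commit n b r).dist.map Prod.fst =
      (piPMF n fun _ => (seedDist (G n)).map (maskBits b r)).map concat := by
  have h : (((piPMF n fun _ => PMF.uniformOfFintype (Bits n)).bind fun k =>
        (piPMF n fun i => ((G n).outDist (k i)).map (maskBits b r)).bind fun y =>
          PMF.pure (concat y, (b, k))).map Prod.fst : PMF (Bits (n * (3 * n)))) =
      (piPMF n fun _ => (seedDist (G n)).map (maskBits b r)).map concat := by
    rw [seedDist, PMF.map_bind, PMF.map_bind, ← piPMF_bind]
    simp only [PMF.map_bind, PMF.pure_map]
    rfl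
  exact (congr_arg (PMF.map Prod.fst) (commit_dist G n b r)).trans h

/-- Masking is a bijection. This makes the final hybrid the same for both committed bits. -/
theorem map_maskBits_uniform {m : ℕ} (b : Bool) (r : Bits m) :
    (PMF.uniformOfFintype (Bits m)).map (maskBits b r) = PMF.uniformOfFintype (Bits m) := by
  ext y
  rw [PMF.map_apply, tsum_eq_single (maskBits b r y)]
  · simp [maskBits_maskBits]
  · intro a ha
    rw [if_neg]
    rintro rfl
    exact ha (maskBits_maskBits b r a).symm

/-- The positions of the `j`-th block of a concatenation. -/
def blockEmb {n m : ℕ} (j : Fin n) : Fin m ↪ Fin (n * m) where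
  toFun i := finProdFinEquiv (j, i)
  inj' _ _ h := (Prod.ext_iff.mp (finProdFinEquiv.injective h)).2

/-- The mask can be stored beforehand in block `j`, as `r` or as zero, and the challenge added to
it. The adversary therefore performs the same operation for both bits. -/
theorem concat_update_maskBits {n m : ℕ} (b : Bool) (r : Bits m) (w : Fin n → Bits m) (j : Fin n)
    (a : Bits m) :
    concat (Function.update w j (maskBits b r a)) =
      flipBits (blockEmb j) a (concat (Function.update w j (maskBits b r fun _ => false))) := by
  funext p
  obtain ⟨⟨j', i⟩, rfl⟩ := finProdFinEquiv.surjective p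
  by_cases h : j' = j
  · subst h
    refine Eq.trans ?_ (flipBits_apply (blockEmb j') a _ i).symm
    change concat _ (finProdFinEquiv (j', i)) = xor (concat _ (finProdFinEquiv (j', i))) _
    simp only [concat, Equiv.symm_apply_apply, Function.update_self]
    cases b <;> simp [maskBits, Bool.xor_comm]
  · rw [flipBits_of_notMem]
    · simp [concat, h]
    · intro i' h'
      exact h (Prod.ext_iff.mp (finProdFinEquiv.injective h')).1.symm

/-- Masked generator outputs are indistinguishable from uniform strings if no choice of the other
blocks makes a single output distinguishable. -/
theorem commit_expectation_le (n : ℕ) (f : Bits (n * (3 * n)) → ℝ) (δ : ℝ)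
    (hf : ∀ (e : Fin (3 * n) ↪ Fin (n * (3 * n))) (z : Bits (n * (3 * n))),
      |∑ y, (seedDist (G n) y).toReal * f (flipBits e y z) -
        ∑ y, (PMF.uniformOfFintype (Bits (3 * n)) y).toReal * f (flipBits e y z)| ≤ δ)
    (r : Bits (3 * n)) :
    |∑ c, ((((naorCommitment G).commit n false r).dist.map Prod.fst) c).toReal * f c -
      ∑ c, ((((naorCommitment G).commit n true r).dist.map Prod.fst) c).toReal * f c| ≤
      2 * n * δ := by
  have hb : ∀ b : Bool,
      |∑ c, ((((naorCommitment G).commit n b r).dist.map Prod.fst) c).toReal * f c -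
        ∑ v : Fin n → Bits (3 * n),
          (∏ i, (PMF.uniformOfFintype (Bits (3 * n)) (v i)).toReal) * f (concat v)| ≤ n * δ := by
    intro b
    have h₁ : ∑ c, ((((naorCommitment G).commit n b r).dist.map Prod.fst) c).toReal * f c =
        ∑ v : Fin n → Bits (3 * n),
          (∏ i, ((seedDist (G n)).map (maskBits b r) (v i)).toReal) * f (concat v) := by
      rw [commit_fst_dist]
      refine (sum_map_toReal _ concat f).trans ?_
      simp only [piPMF_apply, ENNReal.toReal_prod]
    rw [h₁]
    refine hybrid_le (fun _ => ENNReal.toReal_nonneg) (sum_toReal_eq_one _)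
      (fun _ => ENNReal.toReal_nonneg) (sum_toReal_eq_one _) δ n (fun v => f (concat v))
      fun j w => ?_
    conv_lhs => rw [← map_maskBits_uniform b r]
    rw [sum_map_toReal _ _ fun a => f (concat (Function.update w j a)),
      sum_map_toReal _ _ fun a => f (concat (Function.update w j a))]
    refine le_trans (le_of_eq ?_) (hf (blockEmb j)
      (concat (Function.update w j (maskBits b r fun _ => false))))
    congr 2 <;> exact Finset.sum_congr rfl fun a _ => by rw [concat_update_maskBits]
  have h₀ := abs_le.mp (hb false)
  have h₁ := abs_le.mp (hb true)
  rw [abs_le]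
  constructor <;> linarith [h₀.1, h₀.2, h₁.1, h₁.2]

/-- The weight and the leftover state of each outcome `r` do not involve `b`, so the comparison of
the two bits reduces to a fixed `r` and a classical commitment. -/
theorem accept_receiverState {s : ℕ → ℕ}
    (R : NonuniformQPT (fun _ => 0) fun n => (naorCommitment G).qLen n + s n)
    (D : NonuniformQPT (fun n => (naorCommitment G).cLen n + s n) fun _ => 1)
    (w : ∀ n, Bits (3 * n) → ℝ) (ρ : ∀ n, Bits (3 * n) → Op (s n))
    (hρ : ∀ n r, CommitmentScheme.outcomePart (R.run n 1) r = w n r • ρ n r) (n : ℕ) (b : Bool) :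
    D.accept n ((naorCommitment G).receiverState R n b) = ∑ r : Bits (3 * n), w n r *
      ∑ c : Bits (n * (3 * n)), ((((naorCommitment G).commit n b r).dist.map Prod.fst) c).toReal *
        D.accept n (tensor (classicalState (PMF.pure c)) (ρ n r)) := by
  rw [CommitmentScheme.receiverState, D.accept_sum]
  refine Finset.sum_congr rfl fun r _ => ?_
  rw [hρ, tensor_smul_right, D.accept_smul]
  congr 1
  exact D.accept_tensor_classicalState n _ _

theorem hiding_naorCommitment (hG : ∀ A : NonuniformQPT (fun n => 3 * n) fun _ => 1,
    Negligible fun n =>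
      |A.accept n (classicalState ((PMF.uniformOfFintype (Bits n)).bind (G n).outDist)) -
        A.accept n (classicalState (PMF.uniformOfFintype (Bits (3 * n))))|) :
    (naorCommitment G).ComputationallyHiding := by
  intro s R D
  have hσ : ∀ n, IsDensity (R.run n 1) := fun n => R.run_isDensity n isDensity_one
  choose ρ hρ hρeq using fun (n : ℕ) (r : Bits (3 * n)) =>
    exists_isDensity_smul (outcomePart_posSemidef (hσ n).1 r)
  let w : ∀ n, Bits (3 * n) → ℝ := fun n r =>
    (CommitmentScheme.outcomePart (R.run n 1) r).trace.re
  have hw0 : ∀ n r, 0 ≤ w n r := fun n r =>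
    (Complex.le_def.mp (outcomePart_posSemidef (hσ n).1 r).trace_nonneg).1
  have hw1 : ∀ n, ∑ r, w n r = 1 := fun n => sum_trace_outcomePart (hσ n)
  let F : ∀ n, Bits (3 * n) → Bits (n * (3 * n)) → ℝ := fun n r c =>
    D.accept n (tensor (classicalState (PMF.pure c)) (ρ n r))
  let adv : ∀ n, (Fin (3 * n) ↪ Fin (n * (3 * n))) × Bits (n * (3 * n)) × Bits (3 * n) → ℝ :=
    fun n p => |∑ y, (seedDist (G n) y).toReal * F n p.2.2 (flipBits p.1 y p.2.1) -
      ∑ y, (PMF.uniformOfFintype (Bits (3 * n)) y).toReal * F n p.2.2 (flipBits p.1 y p.2.1)|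
  -- Non-uniformity allows the best position, background string and challenge to be chosen
  -- separately for each `n` from a finite set. That set is nonempty because `3 * n ≤ n * (3 * n)`,
  -- also at `n = 0`.
  have hmax : ∀ n, ∃ p, ∀ p', adv n p' ≤ adv n p := by
    intro n
    have : Nonempty (Fin (3 * n) ↪ Fin (n * (3 * n))) := by
      apply Function.Embedding.nonempty_of_card_le
      rw [Fintype.card_fin, Fintype.card_fin]
      rcases Nat.eq_zero_or_pos n with rfl | hn
      · simp
      · exact Nat.le_mul_of_pos_left _ hn
    exact Finite.exists_max (adv n)
  choose p hp using hmax
  let A : NonuniformQPT (fun n => 3 * n) fun _ => 1 :=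
    xorAdversary (c := fun n => n * (3 * n)) D ⟨3 * .X, fun n => by simp⟩ (fun n => (p n).1)
      (fun n => (p n).2.1) (fun n => ρ n (p n).2.2) fun n => hρ n _
  have hA : ∀ n,
      |A.accept n (classicalState ((PMF.uniformOfFintype (Bits n)).bind (G n).outDist)) -
        A.accept n (classicalState (PMF.uniformOfFintype (Bits (3 * n))))| = adv n (p n) := by
    intro n
    exact congr_arg₂ (fun a b : ℝ => |a - b|)
      (xorAdversary_accept (c := fun n => n * (3 * n)) D _ _ _ _ _ n _)
      (xorAdversary_accept (c := fun n => n * (3 * n)) D _ _ _ _ _ n _)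
  have hbound : ∀ n, |D.accept n ((naorCommitment G).receiverState R n false) -
      D.accept n ((naorCommitment G).receiverState R n true)| ≤ 2 * n * adv n (p n) := by
    intro n
    rw [accept_receiverState G R D w ρ hρeq, accept_receiverState G R D w ρ hρeq,
      ← Finset.sum_sub_distrib]
    simp only [← mul_sub]
    exact abs_weighted_sum_le (hw0 n) (hw1 n) fun r =>
      commit_expectation_le G n (F n r) _ (fun e z => hp n (e, z, r)) r
  have hneg : Negligible fun n => adv n (p n) := by
    simpa only [hA] using hG A
  -- The hybrid loss `2 * n` is polynomial and preserves negligibility.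
  have hneg' := (Asymptotics.SuperpolynomialDecay.param_mul hneg).const_mul 2
  refine hneg'.trans_abs_le fun n => ?_
  rw [abs_abs]
  refine (hbound n).trans ((le_abs_self _).trans (le_of_eq ?_))
  simp [mul_assoc]

end QCommit

end

theorem mainTheorem7 (G : ∀ n, QCommit.Circuit n (3 * n))
    (hG : QCommit.IsStrongQPRG (fun n => 3 * n) G) :
    (QCommit.naorCommitment G).Efficient ∧
    (QCommit.naorCommitment G).Correct ∧
    (QCommit.naorCommitment G).ComputationallyHiding ∧
    (QCommit.naorCommitment G).StatisticallyBinding :=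
  ⟨QCommit.efficient_naorCommitment G hG.qpt,
    QCommit.correct_naorCommitment G hG.pseudodeterminism,
    QCommit.hiding_naorCommitment G hG.strong_security,
    QCommit.binding_naorCommitment G⟩
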